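/- **Setting.** The state is $\theta\in\{0,1\}$ (harmful, beneficial), a belief $\mu\in[0,1]$ is the probability of $\theta=1$, the common prior is $\mu_0\in[0,1]$, and the level of R\&D lies in $\mathcal L=[0,\widehat L]$ with $0<\widehat L<\infty$. The agent's and the principal's payoffs are $u(\theta,l)$ and $v(\theta,l)$, upper semicontinuous in $l$; put $U(\mu,l)=\mu u(1,l)+(1-\mu)u(0,l)$ and $V(\mu,l)=\mu v(1,l)+(1-\mu)v(0,l)$. For $f\in\{U,V\}$ let $\widehat l_f(\mu)=\sup\arg\max_{l\in\mathcal L}f(\mu,l)$. Assume: (i) for each $\mu$, $U(\mu,\cdot)$ and $V(\mu,\cdot)$ are single-peaked (nondecreasing up to some level, nonincreasing afterwards); (ii) $\widehat l_U$ and $\widehat l_V$ are continuous and nondecreasing in $\mu$; (iii) $\widehat l_V(\mu)\le\widehat l_U(\mu)$ for every $\mu$. A mechanism is a lower semicontinuous function $\phi:\mathcal L\to\mathbb R\cup\{\pm\infty\}$; if R\&D stops at $l$, the agent pays $\phi(l)$ to the principal. Let $$L^*=\inf\Big(\arg\max_{l\in\mathcal L}\big[U(\mu_0,l)-U(\mu_0,0)\big]+V(\mu_0,l)\Big),\qquad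 \lambda^*=U(\mu_0,L^*)-U(\mu_0,0),$$ and let $\phi^{L^*,\lambda^*}$ be the fixed tax $\lambda^*$ with hard quota $L^*$: $\phi^{L^*,\lambda^*}(l)=\lambda^*$ for $l\le L^*$ and $+\infty$ for $l>L^*$. **Information acquisition.** Let $\mathcal E$ be the set of pairs $(C,H)$ where $H:[0,1]\to\mathbb R$ is concave and continuous and $C:\mathbb R\to\mathbb R$ is weakly increasing with $C(0)=0$; let $\overline{\mathcal E}\supseteq\mathcal E$ be the set defined in the same way with $C:\mathbb R\to\mathbb R\cup\{+\infty\}$. Given $H$, the agent chooses a càdlàg $[0,1]$-valued martingale $(\mu_l)_{l\in\mathcal L}$ of beliefs (with respect to its natural filtration, with mean equal to the prior), for which the flow $I_l=-\mathcal A_lH(\mu_l)$ of uncertainty reduction exists, where $\mathcal A$ is the generator of the process in the sense of the martingale problem: $I$ is progressively measurable and integrable, $H(\mu_l)+\int_0^l I_s\,ds$ is a martingale, and the mean of $H(\mu_l)$ at level $l=0$ is $H$ of the prior (so learning at level $0$ reduces no uncertainty). She also chooses a stopping level $\tau\le\widehat L$ of the natural filtration. Her payoff is $$\mathbb E\Big[U(\mu_\tau,\tau)-\phi(\tau)-\int_0^\tau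 C(I_s)\,ds\Big],$$ and the principal's is $\mathbb E[V(\mu_\tau,\tau)+\phi(\tau)]$ (expectations are extended-real valued, with $\infty-\infty=-\infty$). If the agent does not participate, the payoffs are $U(\mu_0,0)$ and $V(\mu_0,0)$. The agent behaves optimally and breaks indifference in favor of more R\&D: she participates whenever an optimal strategy gives her at least $U(\mu_0,0)$, and she never uses an optimal strategy if waiting longer after its stopping level without any further learning, with positive probability, is also optimal. Non-participation is a best response exactly when every strategy gives her strictly less than $U(\mu_0,0)$. **Theorem.** Fix any selection of a best response of the agent for each $(\phi,C,H)$ for which one exists. Let $W(\phi)$ be the infimum of the principal's resulting payoff over all $(C,H)\in\mathcal E$ for which the agent has a best response to $\phi$, and let $\mathrm{ACQ}=\sup_\phi W(\phi)$, the supremum being over all mechanisms. Then $\phi^{L^*,\lambda^*}$ is a mechanism and attains the max–min value: $$W(\phi^{L^*,\lambda^*})=\mathrm{ACQ}=V(\mu_0,L^*)+\lambda^*.$$ The same holds with $\overline{\mathcal E}$ in place of $\mathcal E$. -/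

import Mathlib

open MeasureTheory Set Filter Topology
open scoped ENNReal NNReal

noncomputable section

namespace TechReg

/-! ### Primitives -/

/-- Levels of R&D, `[0, T]`. -/
abbrev Level (T : ℝ) : Type := Set.Icc (0 : ℝ) T

/-- Lebesgue measure on the levels. -/
def levelMeasure (T : ℝ) : Measure (Level T) := Measure.comap Subtype.val volume

/-- The primitives: the maximal level `Lmax`, the common prior probability `prior` of the beneficial
state, and the payoffs `u` (agent) and `v` (principal). The state `true` is the beneficial
state `θ = 1`, the state `false` the harmful state `θ = 0`. Beliefs are identified with the probability
of `θ = 1`. Only the values of the payoffs at levels in `[0, Lmax]` matter. -/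
structure Environment where
  Lmax : ℝ
  Lmax_pos : 0 < Lmax
  prior : ℝ
  prior_mem : prior ∈ Icc (0 : ℝ) 1
  u : Bool → ℝ → ℝ
  v : Bool → ℝ → ℝ

/-- Expected payoff at level `l` under the belief `μ`. -/
def indirect (w : Bool → ℝ → ℝ) (μ l : ℝ) : ℝ := μ * w true l + (1 - μ) * w false l

/-- Maximizers of `f` over the levels `[0, T]`. -/
def argmaxLevel (T : ℝ) (f : ℝ → ℝ) : Set ℝ := {l | l ∈ Icc 0 T ∧ IsMaxOn f (Icc 0 T) l}

/-- (Weakly) single-peaked: nondecreasing up to some level and nonincreasing afterwards. -/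
def SinglePeaked (T : ℝ) (f : ℝ → ℝ) : Prop :=
  ∃ p ∈ Icc 0 T, MonotoneOn f (Icc 0 p) ∧ AntitoneOn f (Icc p T)

namespace Environment

variable (E : Environment)

/-- The agent's indirect utility. -/
def U (μ l : ℝ) : ℝ := indirect E.u μ l

/-- The principal's indirect utility. -/
def V (μ l : ℝ) : ℝ := indirect E.v μ l

/-- The largest one-shot optimal level of the agent at the belief `μ`. -/
def peakU (μ : ℝ) : ℝ := sSup (argmaxLevel E.Lmax (E.U μ))

/-- The largest one-shot optimal level of the principal at the belief `μ`. -/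
def peakV (μ : ℝ) : ℝ := sSup (argmaxLevel E.Lmax (E.V μ))

/-- The standing assumptions on payoffs. Upper semicontinuity in the level is what makes the
one-shot maximizers exist. -/
structure Regular : Prop where
  usc_u : ∀ θ, UpperSemicontinuousOn (E.u θ) (Icc 0 E.Lmax)
  usc_v : ∀ θ, UpperSemicontinuousOn (E.v θ) (Icc 0 E.Lmax)
  singlePeaked_U : ∀ μ ∈ Icc (0 : ℝ) 1, SinglePeaked E.Lmax (E.U μ)
  singlePeaked_V : ∀ μ ∈ Icc (0 : ℝ) 1, SinglePeaked E.Lmax (E.V μ)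
  continuous_peakU : ContinuousOn E.peakU (Icc 0 1)
  continuous_peakV : ContinuousOn E.peakV (Icc 0 1)
  monotone_peakU : MonotoneOn E.peakU (Icc 0 1)
  monotone_peakV : MonotoneOn E.peakV (Icc 0 1)
  peakV_le_peakU : ∀ μ ∈ Icc (0 : ℝ) 1, E.peakV μ ≤ E.peakU μ

/-! ### Mechanisms -/

/-- Mechanisms: lower semicontinuous transfer schedules on `[0, Lmax]` with values in the extended
reals; `φ l` is paid by the agent to the principal when R&D stops at level `l`. -/
def IsMechanism (φ : Level E.Lmax → EReal) : Prop := LowerSemicontinuous φ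

/-- The hard quota at level `L` with the fixed tax `tax`. -/
def quotaTax (L tax : ℝ) : Level E.Lmax → EReal :=
  fun l => if (l : ℝ) ≤ L then (tax : EReal) else ⊤

/-- `L*`, the smallest maximizer of the joint surplus under the prior. -/
def Lstar : ℝ :=
  sInf (argmaxLevel E.Lmax fun l => (E.U E.prior l - E.U E.prior 0) + E.V E.prior l)

/-- `λ*`, the agent's gain from development up to `L*` under the prior. -/
def taxStar : ℝ := E.U E.prior E.Lstar - E.U E.prior 0

/-- The fixed tax `λ*` with the hard quota `L*`. -/
def phiStar : Level E.Lmax → EReal := E.quotaTax E.Lstar E.taxStar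

end Environment

/-! ### Belief paths -/

/-- Càdlàg belief paths `[0, T] → [0, 1]`. -/
structure BeliefPath (T : ℝ) where
  toFun : Level T → ℝ
  mem_Icc : ∀ l, toFun l ∈ Icc (0 : ℝ) 1
  right_cont : ∀ l, ContinuousWithinAt toFun (Ici l) l
  left_lim : ∀ l, ∃ y, Tendsto toFun (𝓝[<] l) (𝓝 y)

instance (T : ℝ) : CoeFun (BeliefPath T) (fun _ => Level T → ℝ) := ⟨BeliefPath.toFun⟩

/-- The σ-algebra generated by the coordinates. -/
instance (T : ℝ) : MeasurableSpace (BeliefPath T) :=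
  ⨆ l : Level T, MeasurableSpace.comap (fun ω : BeliefPath T => ω l) inferInstance

theorem measurable_coord {T : ℝ} (l : Level T) : Measurable fun ω : BeliefPath T => ω l :=
  Measurable.of_comap_le
    (le_iSup (fun l : Level T =>
      MeasurableSpace.comap (fun ω : BeliefPath T => ω l) inferInstance) l)

/-- The natural filtration generated by belief paths. -/
def pathFiltration (T : ℝ) :
    Filtration (Level T) (inferInstance : MeasurableSpace (BeliefPath T)) :=
  Filtration.natural (fun l ω => ω l) fun l => (measurable_coord l).stronglyMeasurable

/-- The path that follows `ω` up to the level `t` and stays constant afterwards. -/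
def BeliefPath.stopAt {T : ℝ} (ω : BeliefPath T) (t : Level T) : BeliefPath T where
  toFun s := ω (min s t)
  mem_Icc s := ω.mem_Icc _
  right_cont s := by
    refine (ω.right_cont (min s t)).comp (t := Ici (min s t))
      (by fun_prop) (fun x hx => ?_)
    exact min_le_min_right t hx
  left_lim s := by
    rcases le_or_gt s t with h | h
    · obtain ⟨y, hy⟩ := ω.left_lim s
      refine ⟨y, hy.congr' ?_⟩
      filter_upwards [self_mem_nhdsWithin] with x hx
      rw [min_eq_left (le_of_lt (lt_of_lt_of_le hx h))]
    · refine ⟨ω t, tendsto_const_nhds.congr' ?_⟩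
      filter_upwards [mem_nhdsWithin_of_mem_nhds (lt_mem_nhds h)] with x hx
      rw [min_eq_right (le_of_lt hx)]

/-- Expectation of an extended-real random variable, `E[f⁺] - E[f⁻]`, with `∞ - ∞ = -∞`. -/
def extExpectation {Ω : Type*} [MeasurableSpace Ω] (P : Measure Ω) (f : Ω → EReal) : EReal :=
  ((∫⁻ ω, (f ω).toENNReal ∂P : ℝ≥0∞) : EReal) - ((∫⁻ ω, (-f ω).toENNReal ∂P : ℝ≥0∞) : EReal)

/-! ### Information acquisition -/

/-- Measures of uncertainty: concave continuous functions of the belief. -/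
def IsUncertaintyMeasure (H : ℝ → ℝ) : Prop :=
  ConcaveOn ℝ (Icc 0 1) H ∧ ContinuousOn H (Icc 0 1)

/-- Weakly increasing cost functions vanishing at `0`, with values in `ℝ ∪ {+∞}`. -/
def IsCost (C : ℝ → EReal) : Prop := Monotone C ∧ C 0 = 0 ∧ ∀ x, C x ≠ ⊥

/-- Pairs of a cost function and an uncertainty measure, where the cost `+∞` is allowed. -/
def extPairs : Set ((ℝ → EReal) × (ℝ → ℝ)) := {e | IsCost e.1 ∧ IsUncertaintyMeasure e.2}

/-- Pairs of a real-valued cost function and an uncertainty measure. -/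
def realPairs : Set ((ℝ → EReal) × (ℝ → ℝ)) := {e | e ∈ extPairs ∧ ∀ x, e.1 x ≠ ⊤}

/-- What the agent chooses: a belief process, given by its law on path space, and a stopping level
for it. The component `rate` is the speed of learning of the process; it is pinned down by
admissibility. -/
structure Strategy (T : ℝ) where
  law : Measure (BeliefPath T)
  rate : Level T → BeliefPath T → ℝ
  tau : BeliefPath T → Level T

namespace Environment

variable (E : Environment)

/-- Level `0`. -/
def zeroLevel : Level E.Lmax := ⟨0, le_rfl, E.Lmax_pos.le⟩

/-- `P` is the law of a càdlàg martingale in `[0, 1]` that is consistent with the prior. -/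
structure IsBeliefLaw (P : Measure (BeliefPath E.Lmax)) : Prop where
  prob : IsProbabilityMeasure P
  martingale : Martingale (fun l ω => ω l) (pathFiltration E.Lmax) P
  mean : ∫ ω, ω E.zeroLevel ∂P = E.prior

/-- `I` is the speed of learning `I_l = -𝒜_l H(μ_l)`, where `𝒜` is the generator of the belief process
in the sense of the martingale problem: `H(μ_l) + ∫_0^l I_s ds` is a martingale which starts, before
any learning, from `H(prior)`. By Lebesgue differentiation this determines `I` up to null sets
as the (L¹) limit, as `l' ↓ l`, of the conditional expectations of `(H(μ_l) - H(μ_l')) / (l' - l)` given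
the information at `l`. -/
structure IsLearningRate (H : ℝ → ℝ) (P : Measure (BeliefPath E.Lmax))
    (I : Level E.Lmax → BeliefPath E.Lmax → ℝ) : Prop where
  prog : IsStronglyProgressive (pathFiltration E.Lmax) I
  integrable : Integrable (fun p : Level E.Lmax × BeliefPath E.Lmax => I p.1 p.2) ((levelMeasure E.Lmax).prod P)
  dynkin : Martingale (fun l ω => H (ω l) + ∫ s in Iic l, I s ω ∂levelMeasure E.Lmax) (pathFiltration E.Lmax) P
  start : ∫ ω, H (ω E.zeroLevel) ∂P = H E.prior

/-- Strategies available to the agent: belief processes in the domain of the generator, stopped at a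
stopping level of the natural filtration. -/
structure Admissible (H : ℝ → ℝ) (σ : Strategy E.Lmax) : Prop where
  learning : E.IsBeliefLaw σ.law
  rate : E.IsLearningRate H σ.law σ.rate
  stopping : IsStoppingTime (pathFiltration E.Lmax) fun ω => (σ.tau ω : WithTop (Level E.Lmax))

/-- The agent's expected payoff `E[U(μ_l, l) - φ(l) - ∫_0^l C(I_s) ds]`. The speed of learning is
nonnegative almost everywhere since `H` is concave, so nothing is lost by taking the positive part
of the flow cost. -/
def agentPayoff (φ : Level E.Lmax → EReal) (C : ℝ → EReal) (σ : Strategy E.Lmax) : EReal :=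
  extExpectation σ.law fun ω =>
    (E.U (ω (σ.tau ω)) (σ.tau ω) : EReal) - φ (σ.tau ω)
      - ((∫⁻ s in Iic (σ.tau ω), (C (σ.rate s ω)).toENNReal ∂levelMeasure E.Lmax : ℝ≥0∞) : EReal)

/-- What the agent can choose altogether: `some σ` is participation with the strategy `σ`, and `none`
is non-participation.

The agent maximizes her payoff, where non-participation gives `U(prior, 0)`, and resolves
indifference in favor of more R&D: she participates when this is optimal, and no optimal strategy
learns as `σ` does until the level `σ.tau`, learns nothing from then on, and ends R&D later than `σ`
with positive probability. -/
def IsBestResponse (φ : Level E.Lmax → EReal) (C : ℝ → EReal) (H : ℝ → ℝ) :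
    Option (Strategy E.Lmax) → Prop
  | none => ∀ σ, E.Admissible H σ → E.agentPayoff φ C σ < (E.U E.prior 0 : EReal)
  | some σ =>
      E.Admissible H σ ∧ (E.U E.prior 0 : EReal) ≤ E.agentPayoff φ C σ ∧
      (∀ σ', E.Admissible H σ' → E.agentPayoff φ C σ' ≤ E.agentPayoff φ C σ) ∧
      ∀ σ', E.Admissible H σ' → σ'.law = σ.law.map (fun ω => ω.stopAt (σ.tau ω)) →
        (∀ᵐ ω ∂σ'.law, σ.tau ω ≤ σ'.tau ω) →
        E.agentPayoff φ C σ' = E.agentPayoff φ C σ →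
        ∀ᵐ ω ∂σ'.law, σ'.tau ω = σ.tau ω

/-- The principal's expected payoff: `E[V(μ_l, l) + φ(l)]` if the agent participates, and
`V(prior, 0)` if she does not. -/
def principalPayoff (φ : Level E.Lmax → EReal) : Option (Strategy E.Lmax) → EReal
  | none => (E.V E.prior 0 : EReal)
  | some σ => extExpectation σ.law fun ω => (E.V (ω (σ.tau ω)) (σ.tau ω) : EReal) + φ (σ.tau ω)

/-- A selection of the agent's behavior: a best response whenever there is one. -/
def IsSelection
    (sel : (Level E.Lmax → EReal) → (ℝ → EReal) → (ℝ → ℝ) → Option (Strategy E.Lmax)) : Prop :=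
  ∀ φ C H, E.IsMechanism φ → (C, H) ∈ extPairs → (∃ r, E.IsBestResponse φ C H r) →
    E.IsBestResponse φ C H (sel φ C H)

/-- The principal's worst-case payoff over the pairs in `𝓔` for which the agent's problem has a
solution. -/
def worstCase
    (sel : (Level E.Lmax → EReal) → (ℝ → EReal) → (ℝ → ℝ) → Option (Strategy E.Lmax))
    (𝓔 : Set ((ℝ → EReal) × (ℝ → ℝ))) (φ : Level E.Lmax → EReal) : EReal :=
  ⨅ e ∈ {e ∈ 𝓔 | ∃ r, E.IsBestResponse φ e.1 e.2 r},
    E.principalPayoff φ (sel φ e.1 e.2)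

/-- The max–min value of the principal. -/
def ACQ
    (sel : (Level E.Lmax → EReal) → (ℝ → EReal) → (ℝ → ℝ) → Option (Strategy E.Lmax))
    (𝓔 : Set ((ℝ → EReal) × (ℝ → ℝ))) : EReal :=
  ⨆ φ ∈ {φ | E.IsMechanism φ}, E.worstCase sel 𝓔 φ

end Environment

end TechReg

end

open TechReg

/-!
The max–min value is the joint surplus `U(μ₀, L*) - U(μ₀, 0) + V(μ₀, L*)` under the prior, for two
reasons.

*No mechanism guarantees more.* Take the uncertainty measure `H(μ) = -|μ - μ₀|` and a linear cost
`C(x) = K x`. Dynkin's formula at the stopping level (`dynkin_formula`) turns the expected cost of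
any strategy into at least `K 𝔼|μ_τ - μ₀|`, while the payoffs are Lipschitz in the belief, uniformly
in the level, because single-peaked payoffs are bounded. So for large `K` learning never pays: the
agent's value is the maximum of `U(μ₀, l) - φ(l)` over `l`, attained without learning at its largest
maximizer, and at each of her best responses the principal is left with at most the joint surplus net
of the outside option `U(μ₀, 0)` (`exists_pair_principalPayoff_le`). The maximum may be `+∞`; then
every best response gives the principal `-∞`.

*The quota `L*` with the tax `λ*` guarantees as much* (`le_principalPayoff_phiStar`). Developing up to
`L*` without learning gives the agent her outside option, so she participates and a.s. stops
at or before `L*`. After the stopping level `τ` of a best response she could stop learning and wait until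
`min (l̂_U(μ_τ)) L*`. Since `U` is single-peaked this is no worse (`agentPayoff_le_wait`), so breaking
ties in favor of more R&D yields `τ ≥ min (l̂_U(μ_τ)) L*` a.s. (`ae_waitLevel_le_tau`). As
`l̂_V ≤ l̂_U`, either `τ = L*` or `τ` lies beyond the peak of the principal's payoff, and in both cases
`V(μ_τ, τ) ≥ V(μ_τ, L*)`. The right-hand side is affine in the belief, so by optional stopping its
mean is `V(μ₀, L*)`.

The probabilistic input is optional stopping for dominated right-continuous martingales at stopping
levels of the raw natural filtration (`integral_stopped_eq`). It also shows that the law of the stopped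
paths is again an admissible belief process (`admissible_stopLearning`); there the stopping level and
the learning rate can be read off the stopped path, because information up to a level does not separate
paths that agree up to that level (`eq_of_measurable_pathFiltration`).
-/

namespace TechReg

/-! ### Extended-real expectations -/

section Expectation

variable {Ω : Type*} [MeasurableSpace Ω] {P : Measure Ω}

theorem extExpectation_mono {f g : Ω → EReal} (h : f ≤ᵐ[P] g) :
    extExpectation P f ≤ extExpectation P g := by
  refine EReal.sub_le_sub ?_ ?_
  · exact_mod_cast lintegral_mono_ae (h.mono fun ω hω => EReal.toENNReal_le_toENNReal hω)
  · exact_mod_cast lintegral_mono_ae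
      (h.mono fun ω hω => EReal.toENNReal_le_toENNReal (EReal.neg_le_neg_iff.2 hω))

theorem extExpectation_congr {f g : Ω → EReal} (h : f =ᵐ[P] g) :
    extExpectation P f = extExpectation P g :=
  le_antisymm (extExpectation_mono h.le) (extExpectation_mono h.symm.le)

theorem extExpectation_coe {r : Ω → ℝ} (hr : Integrable r P) :
    extExpectation P (fun ω => (r ω : EReal)) = ((∫ ω, r ω ∂P : ℝ) : EReal) := by
  have h1 : (∫⁻ ω, ENNReal.ofReal (r ω) ∂P) ≠ ⊤ := hr.lintegral_lt_top.ne
  have h2 : (∫⁻ ω, ENNReal.ofReal (-r ω) ∂P) ≠ ⊤ := hr.neg.lintegral_lt_top.ne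
  rw [integral_eq_lintegral_pos_part_sub_lintegral_neg_part hr, EReal.coe_sub,
    EReal.coe_ennreal_toReal h1, EReal.coe_ennreal_toReal h2]
  rfl

theorem extExpectation_dirac [MeasurableSingletonClass Ω] (a : Ω) (f : Ω → EReal) :
    extExpectation (Measure.dirac a) f = f a := by
  rw [extExpectation, lintegral_dirac, lintegral_dirac]
  rcases le_total 0 (f a) with h | h
  · rw [EReal.coe_toENNReal h, EReal.toENNReal_of_nonpos (x := -f a) (by simpa using h)]
    simp
  · rw [EReal.coe_toENNReal (x := -f a) (by simpa using h), EReal.toENNReal_of_nonpos h]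
    simp

theorem extExpectation_map {Ω' : Type*} [MeasurableSpace Ω'] {S : Ω → Ω'} (hS : Measurable S)
    {f : Ω' → EReal} (hf : Measurable f) :
    extExpectation (P.map S) f = extExpectation P fun ω => f (S ω) := by
  rw [extExpectation, extExpectation, lintegral_map hf.ereal_toENNReal hS,
    lintegral_map (f := fun ω => (-f ω).toENNReal) hf.neg.ereal_toENNReal hS]

theorem lintegral_neg_ne_top {f : Ω → EReal} (h : extExpectation P f ≠ ⊥) :
    ∫⁻ ω, (-f ω).toENNReal ∂P ≠ ⊤ := by
  intro h2
  apply h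
  rw [extExpectation, h2, EReal.coe_ennreal_top]
  exact EReal.sub_top _

/-- An extended-real random variable dominated by an integrable one and with expectation different
from `-∞` is almost surely real and integrable. -/
theorem exists_integrable_of_extExpectation_ne_bot {f : Ω → EReal} (hf : AEMeasurable f P)
    {r : Ω → ℝ} (hr : Integrable r P) (hfr : ∀ᵐ ω ∂P, f ω ≤ r ω)
    (hbot : extExpectation P f ≠ ⊥) :
    ∃ q : Ω → ℝ, Integrable q P ∧ f =ᵐ[P] fun ω => (q ω : EReal) := by
  have hneg := lintegral_neg_ne_top hbot
  have hm : AEMeasurable (fun ω => (-f ω).toENNReal) P := hf.neg.ereal_toENNReal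
  have hfin := ae_lt_top' hm hneg
  have heq : f =ᵐ[P] fun ω => ((f ω).toReal : EReal) := by
    filter_upwards [hfr, hfin] with ω h1 h2
    rw [EReal.coe_toReal]
    · intro h; rw [h] at h1; exact absurd h1 (by simp)
    · intro h; rw [h] at h2; simp at h2
  refine ⟨fun ω => (f ω).toReal, ?_, heq⟩
  have hrm : AEMeasurable (fun ω => (f ω).toReal) P := hf.ereal_toReal
  refine ⟨hrm.aestronglyMeasurable, ?_⟩
  rw [hasFiniteIntegral_iff_norm]
  calc ∫⁻ ω, ENNReal.ofReal ‖(f ω).toReal‖ ∂P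
      ≤ ∫⁻ ω, (ENNReal.ofReal ‖r ω‖ + (-f ω).toENNReal) ∂P := by
        refine lintegral_mono_ae ?_
        filter_upwards [hfr, heq] with ω h1 h2
        generalize (f ω).toReal = q at h2
        rw [h2] at h1 ⊢
        have h1' : q ≤ r ω := by exact_mod_cast h1
        rw [← EReal.coe_neg, EReal.real_coe_toENNReal]
        rw [Real.norm_eq_abs, Real.norm_eq_abs]
        rcases le_total 0 q with h | h
        · rw [abs_of_nonneg h]
          exact le_add_right (ENNReal.ofReal_le_ofReal (h1'.trans (le_abs_self _)))
        · rw [abs_of_nonpos h]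
          exact le_add_left le_rfl
    _ = ∫⁻ ω, ENNReal.ofReal ‖r ω‖ ∂P + ∫⁻ ω, (-f ω).toENNReal ∂P :=
        lintegral_add_left' (hr.norm.aestronglyMeasurable.aemeasurable.ennreal_ofReal) _
    _ < ⊤ := ENNReal.add_lt_top.2 ⟨hr.norm.lintegral_lt_top, hneg.lt_top⟩

/-- Splitting a surplus `R` between a party that gets at least `a` in expectation and a second one
leaves at most `E[R] - a` for the second. -/
theorem extExpectation_le_sub {f g : Ω → EReal} (hf : AEMeasurable f P)
    {r R : Ω → ℝ} (hr : Integrable r P) (hR : Integrable R P) (hfr : ∀ᵐ ω ∂P, f ω ≤ r ω)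
    (hg : ∀ᵐ ω ∂P, g ω ≤ R ω - f ω) {a : ℝ} (ha : (a : EReal) ≤ extExpectation P f) :
    extExpectation P g ≤ ((∫ ω, R ω ∂P - a : ℝ) : EReal) := by
  obtain ⟨q, hq, hfq⟩ := exists_integrable_of_extExpectation_ne_bot hf hr hfr
    (fun h => by rw [h] at ha; simp at ha)
  rw [extExpectation_congr hfq, extExpectation_coe hq] at ha
  have ha' : a ≤ ∫ ω, q ω ∂P := by exact_mod_cast ha
  calc extExpectation P g ≤ extExpectation P fun ω => ((R ω - q ω : ℝ) : EReal) := by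
        refine extExpectation_mono ?_
        filter_upwards [hg, hfq] with ω h1 h2
        rw [EReal.coe_sub, ← h2]; exact h1
    _ = ((∫ ω, (R ω - q ω) ∂P : ℝ) : EReal) := extExpectation_coe (hR.sub hq)
    _ ≤ _ := by
        rw [integral_sub hR hq]
        exact_mod_cast sub_le_sub_left ha' _

/-- If the sum of two payoffs is bounded above and one has expectation `+∞`, the other has
expectation `-∞`. -/
theorem extExpectation_eq_bot [IsFiniteMeasure P] {f g : Ω → EReal} {N : ℝ}
    (hfg : ∀ ω, f ω ≤ N + -g ω) (hf : extExpectation P f = ⊤) : extExpectation P g = ⊥ := by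
  by_contra hg
  have hneg := lintegral_neg_ne_top hg
  have hpos : ∫⁻ ω, (f ω).toENNReal ∂P ≠ ⊤ := by
    refine ne_top_of_le_ne_top ?_ (lintegral_mono fun ω =>
      (EReal.toENNReal_le_toENNReal (hfg ω)).trans EReal.toENNReal_add_le)
    rw [lintegral_add_left measurable_const, EReal.real_coe_toENNReal]
    exact ENNReal.add_ne_top.2 ⟨by simp [ENNReal.mul_eq_top], hneg⟩
  have h2 : extExpectation P f ≤ ((∫⁻ ω, (f ω).toENNReal ∂P : ℝ≥0∞) : EReal) :=
    EReal.sub_le_of_le_add (le_add_of_nonneg_right (EReal.coe_ennreal_nonneg _))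
  rw [hf, top_le_iff, EReal.coe_ennreal_eq_top_iff] at h2
  exact hpos h2

end Expectation

/-! ### Optional stopping -/

/-- The smallest point of the mesh `ℕ / (n + 1)` above `s`, capped at the maximal level. -/
noncomputable def gridUp {T : ℝ} (hT : 0 ≤ T) (n : ℕ) (s : Level T) : Level T :=
  projIcc 0 T hT ((⌈(s : ℝ) * (n + 1)⌉₊ : ℝ) / (n + 1))

section Grid

variable {T : ℝ} (hT : 0 ≤ T)

theorem le_gridUp (n : ℕ) (s : Level T) : s ≤ gridUp hT n s := by
  rw [gridUp, ← projIcc_val hT s]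
  refine monotone_projIcc hT ?_
  rw [projIcc_val, le_div_iff₀ (by positivity)]
  exact Nat.le_ceil _

theorem measurable_gridUp (n : ℕ) : Measurable (gridUp hT n) := by
  refine continuous_projIcc.measurable.comp (Measurable.div_const ?_ _)
  exact measurable_from_nat.comp (Nat.measurable_ceil.comp (measurable_subtype_coe.mul_const _))

theorem countable_range_gridUp (n : ℕ) : (range (gridUp hT n)).Countable := by
  refine (countable_range fun k : ℕ => projIcc 0 T hT ((k : ℝ) / (n + 1))).mono ?_
  rintro _ ⟨s, rfl⟩
  exact ⟨_, rfl⟩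

theorem tendsto_gridUp (s : Level T) :
    Tendsto (fun n => gridUp hT n s) atTop (𝓝[≥] s) := by
  refine tendsto_nhdsWithin_iff.2 ⟨?_, Eventually.of_forall fun n => le_gridUp hT n s⟩
  have h : Tendsto (fun n : ℕ => (⌈(s : ℝ) * (n + 1)⌉₊ : ℝ) / (n + 1)) atTop (𝓝 (s : ℝ)) := by
    have hub : Tendsto (fun n : ℕ => (s : ℝ) + 1 / ((n : ℝ) + 1)) atTop (𝓝 (s : ℝ)) := by
      simpa using tendsto_const_nhds.add (tendsto_one_div_add_atTop_nhds_zero_nat (𝕜 := ℝ))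
    refine tendsto_of_tendsto_of_tendsto_of_le_of_le tendsto_const_nhds hub ?_ ?_
    · intro n
      rw [le_div_iff₀ (by positivity)]
      exact Nat.le_ceil _
    · intro n
      have hn : (0 : ℝ) < n + 1 := by positivity
      change _ / _ ≤ (s : ℝ) + 1 / ((n : ℝ) + 1)
      rw [div_le_iff₀ hn, add_mul, one_div, inv_mul_cancel₀ hn.ne']
      exact (Nat.ceil_lt_add_one (mul_nonneg s.2.1 hn.le)).le
  have := (continuous_projIcc (h := hT)).continuousAt.tendsto.comp h
  rwa [projIcc_val] at this

end Grid

section OptionalStopping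

variable {T : ℝ} {Ω : Type*} {m : MeasurableSpace Ω} {F : Filtration (Level T) m}
  {τ : Ω → Level T}

theorem measurableSet_le_of_isStoppingTime
    (hτ : IsStoppingTime F fun ω => (τ ω : WithTop (Level T))) (i : Level T) :
    MeasurableSet[F i] {ω | τ ω ≤ i} := by
  simpa using hτ i

theorem isStoppingTime_coe (hτ : ∀ i, MeasurableSet[F i] {ω | τ ω ≤ i}) :
    IsStoppingTime F fun ω => (τ ω : WithTop (Level T)) := by
  intro i
  simpa using hτ i

theorem measurable_min_of_isStoppingTime
    (hτ : IsStoppingTime F fun ω => (τ ω : WithTop (Level T))) (i : Level T) :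
    Measurable[F i] fun ω => min (τ ω) i := by
  refine measurable_of_Iic (hf := ?_)
  intro j
  rcases le_or_gt i j with h | h
  · have : (fun ω => min (τ ω) i) ⁻¹' Iic j = univ := by
      ext ω; simp [h]
    rw [this]; exact MeasurableSet.univ
  · have : (fun ω => min (τ ω) i) ⁻¹' Iic j = {ω | τ ω ≤ j} := by
      ext ω
      simp [h.not_ge]
    rw [this]
    exact F.mono h.le _ (measurableSet_le_of_isStoppingTime hτ j)

theorem measurable_of_isStoppingTime (hT : 0 ≤ T)
    (hτ : IsStoppingTime F fun ω => (τ ω : WithTop (Level T))) : Measurable τ := by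
  have h := (measurable_min_of_isStoppingTime hτ ⟨T, hT, le_rfl⟩).mono (F.le _) le_rfl
  have h2 : (fun ω => min (τ ω) (⟨T, hT, le_rfl⟩ : Level T)) = τ := by
    funext ω
    exact min_eq_left (τ ω).2.2
  rwa [h2] at h

theorem isStoppingTime_of_le {g : Level T → Level T} (hg : Measurable g) (hle : ∀ s, s ≤ g s)
    (hτ : IsStoppingTime F fun ω => (τ ω : WithTop (Level T))) :
    IsStoppingTime F fun ω => (g (τ ω) : WithTop (Level T)) := by
  refine isStoppingTime_coe fun i => ?_
  have h : {ω | g (τ ω) ≤ i} = {ω | τ ω ≤ i} ∩ {ω | g (min (τ ω) i) ≤ i} := by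
    ext ω
    constructor
    · intro h
      have h' : τ ω ≤ i := (hle _).trans h
      exact ⟨h', by simpa [min_eq_left h'] using h⟩
    · rintro ⟨h', h⟩
      rw [mem_ofPred_eq] at h' h
      rwa [min_eq_left h'] at h
  rw [h]
  exact (measurableSet_le_of_isStoppingTime hτ i).inter
    ((hg.comp (measurable_min_of_isStoppingTime hτ i)) measurableSet_Iic)

/-- Optional stopping for a dominated right-continuous martingale: its stopped value is the limit
of the values at the upper mesh points of the stopping level. -/
theorem integral_stopped_eq {P : Measure Ω} [IsProbabilityMeasure P] {X : Level T → Ω → ℝ}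
    (hX : Martingale X F P) {g : Ω → ℝ} (hg : Integrable g P)
    (hbd : ∀ᵐ ω ∂P, ∀ l, |X l ω| ≤ g ω)
    (hrc : ∀ᵐ ω ∂P, ∀ l, ContinuousWithinAt (fun l => X l ω) (Ici l) l)
    (hτ : IsStoppingTime F fun ω => (τ ω : WithTop (Level T))) (s : Level T) :
    ∫ ω, X (τ ω) ω ∂P = ∫ ω, X s ω ∂P := by
  have hT : 0 ≤ T := s.2.1.trans s.2.2
  have hconst : ∀ i j : Level T, i ≤ j → ∫ ω, X i ω ∂P = ∫ ω, X j ω ∂P := fun i j hij => by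
    simpa using hX.setIntegral_eq hij MeasurableSet.univ
  have hstep : ∀ n, AEStronglyMeasurable (fun ω => X (gridUp hT n (τ ω)) ω) P ∧
      ∫ ω, X (gridUp hT n (τ ω)) ω ∂P = ∫ ω, X s ω ∂P := by
    intro n
    -- The mesh has countably many points, so the discrete optional sampling theorem applies.
    have hst := isStoppingTime_of_le (measurable_gridUp hT n) (le_gridUp hT n) hτ
    have hle : ∀ ω, (gridUp hT n (τ ω) : WithTop (Level T)) ≤ ((⟨T, hT, le_rfl⟩ : Level T)) :=
      fun ω => WithTop.coe_le_coe.2 (gridUp hT n (τ ω)).2.2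
    have hcr : (range fun ω => (gridUp hT n (τ ω) : WithTop (Level T))).Countable := by
      refine ((countable_range_gridUp hT n).image WithTop.some).mono ?_
      rintro _ ⟨ω, rfl⟩
      exact ⟨_, ⟨τ ω, rfl⟩, rfl⟩
    have : Nonempty (Level T) := ⟨s⟩
    have h := hX.stoppedValue_ae_eq_condExp_of_le_const_of_countable_range hst hle hcr
    have h' : (fun ω => X (gridUp hT n (τ ω)) ω) =ᵐ[P]
        P[X ⟨T, hT, le_rfl⟩ | hst.measurableSpace] := h
    refine ⟨(integrable_condExp.aestronglyMeasurable).congr h'.symm, ?_⟩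
    rw [integral_congr_ae h', integral_condExp hst.measurableSpace_le]
    exact (hconst _ _ s.2.2).symm
  have hlim : Tendsto (fun n => ∫ ω, X (gridUp hT n (τ ω)) ω ∂P) atTop
      (𝓝 (∫ ω, X (τ ω) ω ∂P)) := by
    refine tendsto_integral_of_dominated_convergence g (fun n => (hstep n).1) hg (fun n => ?_) ?_
    · filter_upwards [hbd] with ω h using h _
    · filter_upwards [hrc] with ω h using (h (τ ω)).tendsto.comp (tendsto_gridUp hT (τ ω))
  simp only [fun n => (hstep n).2] at hlim
  exact tendsto_nhds_unique hlim tendsto_const_nhds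

/-- The martingale property of the stopped process, tested on the events `B` known at level `i`: it
is optional stopping for the stopping level that is `τ ∧ j` on `B` and `τ ∧ i` outside. -/
theorem setIntegral_stopped_eq {P : Measure Ω} [IsProbabilityMeasure P] {X : Level T → Ω → ℝ}
    (hX : Martingale X F P) {g : Ω → ℝ} (hg : Integrable g P)
    (hbd : ∀ᵐ ω ∂P, ∀ l, |X l ω| ≤ g ω)
    (hrc : ∀ᵐ ω ∂P, ∀ l, ContinuousWithinAt (fun l => X l ω) (Ici l) l)
    (hτ : IsStoppingTime F fun ω => (τ ω : WithTop (Level T))) {i j : Level T} (hij : i ≤ j)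
    (hint : ∀ l, Integrable (fun ω => X (min (τ ω) l) ω) P)
    {B : Set Ω} (hB : MeasurableSet[F i] B) :
    ∫ ω in B, X (min (τ ω) j) ω ∂P = ∫ ω in B, X (min (τ ω) i) ω ∂P := by
  classical
  have hτ' : IsStoppingTime F fun ω =>
      ((if ω ∈ B then min (τ ω) j else min (τ ω) i : Level T) : WithTop (Level T)) := by
    refine isStoppingTime_coe fun r => ?_
    have hle := measurableSet_le_of_isStoppingTime hτ
    rcases lt_or_ge r i with hr | hr
    · convert hle r using 1
      ext ω
      by_cases hω : ω ∈ B <;> simp [hω, hr.not_ge, (hr.trans_le hij).not_ge]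
    · have : {ω | (if ω ∈ B then min (τ ω) j else min (τ ω) i) ≤ r} =
          B ∩ {ω | min (τ ω) j ≤ r} ∪ Bᶜ := by
        ext ω
        by_cases hω : ω ∈ B <;> simp [hω, hr]
      rw [this]
      refine (((F.mono hr) _ hB).inter ?_).union ((F.mono hr) _ hB).compl
      rcases lt_or_ge r j with hrj | hrj
      · convert hle r using 1
        ext ω
        simp [hrj.not_ge]
      · convert MeasurableSet.univ using 1
        ext ω
        simp [hrj]
  have hi : IsStoppingTime F fun ω => ((min (τ ω) i : Level T) : WithTop (Level T)) := by
    refine isStoppingTime_coe fun r => ?_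
    rcases lt_or_ge r i with hr | hr
    · convert measurableSet_le_of_isStoppingTime hτ r using 1
      ext ω
      simp [hr.not_ge]
    · convert MeasurableSet.univ using 1
      ext ω
      simp [hr]
  have h1 := integral_stopped_eq hX hg hbd hrc hτ' i
  rw [← integral_stopped_eq hX hg hbd hrc hi i] at h1
  have hBm : MeasurableSet B := F.le i _ hB
  have hsplit : ∀ ω, X (if ω ∈ B then min (τ ω) j else min (τ ω) i) ω =
      B.indicator (fun ω => X (min (τ ω) j) ω) ω +
        Bᶜ.indicator (fun ω => X (min (τ ω) i) ω) ω := by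
    intro ω
    by_cases hω : ω ∈ B <;> simp [hω]
  simp only [hsplit] at h1
  rw [integral_add ((hint j).indicator hBm) ((hint i).indicator hBm.compl),
    integral_indicator hBm, integral_indicator hBm.compl,
    ← integral_add_compl hBm (hint i)] at h1
  exact add_right_cancel h1

end OptionalStopping

/-! ### Measurability on path space -/

section Paths

variable {T : ℝ}

@[ext]
theorem BeliefPath.ext {ω ω' : BeliefPath T} (h : ∀ l, ω l = ω' l) : ω = ω' := by
  cases ω; cases ω'
  congr
  exact funext h

theorem measurable_path_of_coord {Ω : Type*} {m : MeasurableSpace Ω} {S : Ω → BeliefPath T}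
    (h : ∀ l, Measurable fun ω => S ω l) : Measurable S := by
  refine measurable_iff_comap_le.2 ?_
  change MeasurableSpace.comap S (⨆ l : Level T,
    MeasurableSpace.comap (fun ω : BeliefPath T => ω l) inferInstance) ≤ m
  rw [MeasurableSpace.comap_iSup]
  refine iSup_le fun l => ?_
  rw [MeasurableSpace.comap_comp]
  exact measurable_iff_comap_le.1 (h l)

theorem measurable_coord_pathFiltration {l i : Level T} (h : l ≤ i) :
    Measurable[pathFiltration T i] fun ω : BeliefPath T => ω l :=
  measurable_iff_comap_le.2 (le_iSup₂_of_le (f := fun (j : Level T) (_ : j ≤ i) =>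
    MeasurableSpace.comap (fun ω : BeliefPath T => ω j) inferInstance) l h le_rfl)

/-- A map into path space is measurable for the information up to `i` as soon as its coordinates up to
`i` are. -/
theorem measurable_pathFiltration_of_coord {Ω : Type*} {m : MeasurableSpace Ω}
    {S : Ω → BeliefPath T} {i : Level T} (h : ∀ l ≤ i, Measurable fun ω => S ω l) :
    Measurable[m, pathFiltration T i] S := by
  refine measurable_iff_comap_le.2 ?_
  change MeasurableSpace.comap S (⨆ j, ⨆ (_ : j ≤ i),
    MeasurableSpace.comap (fun ω : BeliefPath T => ω j) inferInstance) ≤ m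
  rw [MeasurableSpace.comap_iSup]
  refine iSup_le fun l => ?_
  rw [MeasurableSpace.comap_iSup]
  refine iSup_le fun hl => ?_
  rw [MeasurableSpace.comap_comp]
  exact measurable_iff_comap_le.1 (h l hl)

/-- Information up to level `i` does not separate paths that agree up to `i`. -/
theorem eq_of_measurable_pathFiltration {β : Type*} [MeasurableSpace β] [MeasurableSingletonClass β]
    {f : BeliefPath T → β} {i : Level T} (hf : Measurable[pathFiltration T i] f)
    {ω ω' : BeliefPath T} (h : ∀ l ≤ i, ω l = ω' l) : f ω = f ω' := by
  -- The constant random variables `ω` and `ω'` are compared on a two-point space with the trivial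
  -- σ-algebra, for which every measurable map is constant.
  let S : Bool → BeliefPath T := fun b => if b then ω else ω'
  have hS : @Measurable _ _ ⊥ (pathFiltration T i) S := by
    refine @measurable_pathFiltration_of_coord T Bool ⊥ S i fun l hl => ?_
    have : (fun b => S b l) = fun _ => ω l := by
      funext b
      cases b
      · exact (h l hl).symm
      · rfl
    rw [this]
    exact @measurable_const _ _ _ ⊥ _
  have h2 := (hf.comp hS) (measurableSet_singleton (f ω))
  rw [MeasurableSpace.measurableSet_bot_iff] at h2
  rcases h2 with h2 | h2
  · exact absurd (show true ∈ (f ∘ S) ⁻¹' {f ω} from rfl) (by rw [h2]; simp)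
  · exact (show false ∈ (f ∘ S) ⁻¹' {f ω} by rw [h2]; trivial).symm

/-- Right-continuous adapted processes are progressive, here for the coordinate process. -/
theorem measurable_eval_pathFiltration (i : Level T) :
    Measurable[(inferInstance : MeasurableSpace (Level T)).prod (pathFiltration T i)]
      fun p : Level T × BeliefPath T => p.2 (min p.1 i) := by
  have hT : 0 ≤ T := i.2.1.trans i.2.2
  let _ : MeasurableSpace (BeliefPath T) := pathFiltration T i
  refine measurable_of_tendsto_metrizable
    (f := fun n (p : Level T × BeliefPath T) => p.2 (min (gridUp hT n p.1) i)) (fun n => ?_) ?_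
  · have h1 : Measurable fun q : ℕ × BeliefPath T =>
        q.2 (min (projIcc 0 T hT ((q.1 : ℝ) / (n + 1))) i) :=
      measurable_from_prod_countable_right fun k =>
        measurable_coord_pathFiltration
          (l := min (projIcc 0 T hT ((k : ℝ) / (n + 1))) i) (min_le_right _ _)
    have h2 : Measurable fun p : Level T × BeliefPath T => (⌈(p.1 : ℝ) * (n + 1)⌉₊, p.2) :=
      (Nat.measurable_ceil.comp ((measurable_subtype_coe.comp measurable_fst).mul_const _)).prodMk
        measurable_snd
    exact h1.comp h2
  · rw [tendsto_pi_nhds]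
    intro p
    refine (p.2.right_cont (min p.1 i)).tendsto.comp (tendsto_nhdsWithin_iff.2 ⟨?_, ?_⟩)
    · exact ((continuous_id.min continuous_const).tendsto _).comp
        (tendsto_nhds_of_tendsto_nhdsWithin (tendsto_gridUp hT p.1))
    · exact Eventually.of_forall fun n => min_le_min_right i (le_gridUp hT n p.1)

theorem measurable_eval (hT : 0 ≤ T) :
    Measurable fun p : Level T × BeliefPath T => p.2 p.1 := by
  have h := (measurable_eval_pathFiltration (T := T) ⟨T, hT, le_rfl⟩).mono
    (sup_le_sup le_rfl (MeasurableSpace.comap_mono ((pathFiltration T).le _))) le_rfl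
  have h2 : (fun p : Level T × BeliefPath T => p.2 (min p.1 ⟨T, hT, le_rfl⟩)) =
      fun p => p.2 p.1 := by
    funext p
    rw [min_eq_left]
    exact p.1.2.2
  rwa [h2] at h

/-- A càdlàg path is determined by its values at countably many levels. -/
theorem measurableSingletonClass_beliefPath (hT : 0 ≤ T) :
    MeasurableSingletonClass (BeliefPath T) := by
  refine ⟨fun ω => ?_⟩
  have h : {ω} = ⋂ q : ℕ × ℕ, {ω' : BeliefPath T |
      ω' (projIcc 0 T hT ((q.1 : ℝ) / (q.2 + 1))) = ω (projIcc 0 T hT ((q.1 : ℝ) / (q.2 + 1)))} := by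
    ext ω'
    simp only [mem_singleton_iff, mem_iInter, mem_ofPred_eq]
    refine ⟨fun h q => by rw [h], fun h => BeliefPath.ext fun l => ?_⟩
    have h1 := (ω'.right_cont l).tendsto.comp (tendsto_gridUp hT l)
    have h2 := (ω.right_cont l).tendsto.comp (tendsto_gridUp hT l)
    refine tendsto_nhds_unique h1 (h2.congr fun n => ?_)
    exact (h (⌈(l : ℝ) * (n + 1)⌉₊, n)).symm
  rw [h]
  exact MeasurableSet.iInter fun q => measurable_coord _ (measurableSet_singleton _)

end Paths


/-! ### The learning rate and its integral -/

section Rates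

variable {T : ℝ}

instance : IsFiniteMeasure (levelMeasure T) := by
  refine ⟨?_⟩
  rw [levelMeasure, (MeasurableEmbedding.subtype_coe measurableSet_Icc).comap_apply,
    image_univ, Subtype.range_coe, Real.volume_Icc]
  exact ENNReal.ofReal_lt_top

theorem levelMeasure_singleton (l : Level T) : levelMeasure T {l} = 0 := by
  rw [levelMeasure, (MeasurableEmbedding.subtype_coe measurableSet_Icc).comap_apply,
    image_singleton, Real.volume_singleton]

theorem stronglyMeasurable_rate (hT : 0 ≤ T) {I : Level T → BeliefPath T → ℝ}
    (hI : IsStronglyProgressive (pathFiltration T) I) :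
    StronglyMeasurable fun p : Level T × BeliefPath T => I p.1 p.2 := by
  have h := hI ⟨T, hT, le_rfl⟩
  refine h.comp_measurable (g := fun p : Level T × BeliefPath T =>
    ((⟨p.1, p.1.2.2⟩ : Iic (⟨T, hT, le_rfl⟩ : Level T)), p.2)) ?_
  refine Measurable.prodMk (Measurable.subtype_mk measurable_fst) ?_
  exact measurable_snd.mono le_rfl ((pathFiltration T).le _)

theorem continuousWithinAt_setIntegral_Iic {f : Level T → ℝ} (hf : Integrable f (levelMeasure T))
    (l : Level T) :
    ContinuousWithinAt (fun l => ∫ s in Iic l, f s ∂levelMeasure T) (Ici l) l := by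
  have h : ∀ l, ∫ s in Iic l, f s ∂levelMeasure T =
      ∫ s, (Iic l).indicator f s ∂levelMeasure T :=
    fun l => (integral_indicator measurableSet_Iic).symm
  simp only [ContinuousWithinAt, h]
  refine tendsto_integral_filter_of_dominated_convergence (fun s => ‖f s‖) ?_ ?_ hf.norm ?_
  · exact Eventually.of_forall fun l' => (hf.indicator measurableSet_Iic).aestronglyMeasurable
  · exact Eventually.of_forall fun l' => Eventually.of_forall fun s => norm_indicator_le_norm_self _ _
  · refine Eventually.of_forall fun s => tendsto_const_nhds.congr' ?_
    rcases le_or_gt s l with h | h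
    · filter_upwards [self_mem_nhdsWithin] with l' hl'
      rw [indicator_of_mem (show s ∈ Iic l from h),
        indicator_of_mem (show s ∈ Iic l' from h.trans hl')]
    · filter_upwards [mem_nhdsWithin_of_mem_nhds (gt_mem_nhds h)] with l' hl'
      rw [indicator_of_notMem (show s ∉ Iic l from h.not_ge),
        indicator_of_notMem (show s ∉ Iic l' from (not_le_of_gt hl'))]

/-- The learning rate that is switched off after the level `τ`. -/
noncomputable def stoppedRate (τ : BeliefPath T → Level T) (I : Level T → BeliefPath T → ℝ)
    (s : Level T) (ω : BeliefPath T) : ℝ := if s ≤ τ ω then I s ω else 0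

theorem setIntegral_stoppedRate (τ : BeliefPath T → Level T) (I : Level T → BeliefPath T → ℝ)
    (l : Level T) (ω : BeliefPath T) :
    ∫ s in Iic l, stoppedRate τ I s ω ∂levelMeasure T =
      ∫ s in Iic (min (τ ω) l), I s ω ∂levelMeasure T := by
  have : (fun s => stoppedRate τ I s ω) = (Iic (τ ω)).indicator fun s => I s ω := by
    funext s
    by_cases h : s ≤ τ ω <;> simp [stoppedRate, h]
  rw [this, setIntegral_indicator measurableSet_Iic, Iic_inter_Iic, min_comm]

theorem isStronglyProgressive_stoppedRate {τ : BeliefPath T → Level T}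
    (hτ : IsStoppingTime (pathFiltration T) fun ω => (τ ω : WithTop (Level T)))
    {I : Level T → BeliefPath T → ℝ} (hI : IsStronglyProgressive (pathFiltration T) I) :
    IsStronglyProgressive (pathFiltration T) (stoppedRate τ I) := by
  intro i
  let _ : MeasurableSpace (BeliefPath T) := pathFiltration T i
  refine StronglyMeasurable.ite ?_ (hI i) stronglyMeasurable_const
  have : {p : Iic i × BeliefPath T | (p.1 : Level T) ≤ τ p.2} =
      {p | (p.1 : Level T) ≤ min (τ p.2) i} := by
    ext p
    simp only [mem_ofPred_eq, le_min_iff]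
    exact ⟨fun h => ⟨h, p.1.2⟩, And.left⟩
  rw [this]
  exact measurableSet_le (measurable_subtype_coe.comp measurable_fst)
    ((measurable_min_of_isStoppingTime hτ i).comp measurable_snd)

theorem stronglyMeasurable_setIntegral_rate {I : Level T → BeliefPath T → ℝ}
    (hI : IsStronglyProgressive (pathFiltration T) I) (l : Level T) :
    StronglyMeasurable[pathFiltration T l] fun ω => ∫ s in Iic l, I s ω ∂levelMeasure T := by
  let _ : MeasurableSpace (BeliefPath T) := pathFiltration T l
  have h := StronglyMeasurable.integral_prod_left (f := fun (s : Iic l) ω => I s ω)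
    (μ := Measure.comap Subtype.val (levelMeasure T)) (hI l)
  convert h using 2 with ω
  exact (integral_subtype_comap measurableSet_Iic fun s => I s ω).symm

end Rates

/-! ### Learning until a stopping level -/

section Stop

variable {T : ℝ} {τ : BeliefPath T → Level T}

theorem measurable_stopAt (hτ : IsStoppingTime (pathFiltration T) fun ω => (τ ω : WithTop (Level T)))
    (i : Level T) :
    Measurable[pathFiltration T i, pathFiltration T i] fun ω => ω.stopAt (τ ω) := by
  let _ : MeasurableSpace (BeliefPath T) := pathFiltration T i
  refine measurable_pathFiltration_of_coord fun l hl => ?_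
  have h1 : Measurable fun ω : BeliefPath T => (min l (min (τ ω) i), ω) :=
    (measurable_const.min (measurable_min_of_isStoppingTime hτ i)).prodMk measurable_id
  have h2 : (fun ω : BeliefPath T => ω.stopAt (τ ω) l) =
      fun ω => ω (min (min l (min (τ ω) i)) i) := by
    funext ω
    have : min (min l (min (τ ω) i)) i = min l (τ ω) := by
      rw [min_assoc, min_assoc, min_self, min_left_comm, min_eq_left hl, min_comm]
    rw [this]
    rfl
  rw [h2]
  exact (measurable_eval_pathFiltration i).comp h1

theorem measurable_stopAt' (hT : 0 ≤ T)
    (hτ : IsStoppingTime (pathFiltration T) fun ω => (τ ω : WithTop (Level T))) :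
    Measurable fun ω : BeliefPath T => ω.stopAt (τ ω) :=
  measurable_path_of_coord fun l => ((measurable_coord_pathFiltration
    (show l ≤ ⟨T, hT, le_rfl⟩ from l.2.2)).comp (measurable_stopAt hτ ⟨T, hT, le_rfl⟩)).mono
      ((pathFiltration T).le _) le_rfl

theorem stopAt_apply_of_le {ω : BeliefPath T} {t l : Level T} (h : l ≤ t) :
    ω.stopAt t l = ω l := by
  change ω (min l t) = ω l
  rw [min_eq_left h]

theorem stopAt_apply_of_ge {ω : BeliefPath T} {t l : Level T} (h : t ≤ l) :
    ω.stopAt t l = ω t := by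
  change ω (min l t) = ω t
  rw [min_eq_right h]

/-- A stopping level of the natural filtration is determined by the path up to that level. -/
theorem tau_stopAt (hτ : IsStoppingTime (pathFiltration T) fun ω => (τ ω : WithTop (Level T)))
    (ω : BeliefPath T) : τ (ω.stopAt (τ ω)) = τ ω := by
  have hagree : ∀ l ≤ τ ω, ω l = ω.stopAt (τ ω) l := fun l hl => (stopAt_apply_of_le hl).symm
  have h1 := eq_of_measurable_pathFiltration (measurable_min_of_isStoppingTime hτ (τ ω)) hagree
  have hle : Measurable[pathFiltration T (τ ω)] fun ω' => τ ω' ≤ τ ω := by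
    let _ : MeasurableSpace (BeliefPath T) := pathFiltration T (τ ω)
    exact measurableSet_setOfPred.1 (measurableSet_le_of_isStoppingTime hτ (τ ω))
  have h2 := eq_of_measurable_pathFiltration hle hagree
  have h3 : τ (ω.stopAt (τ ω)) ≤ τ ω := by
    rw [← h2]
  rw [min_self, min_eq_left h3] at h1
  exact h1.symm

theorem rate_stopAt {I : Level T → BeliefPath T → ℝ}
    (hI : IsStronglyProgressive (pathFiltration T) I) {ω : BeliefPath T} {s t : Level T}
    (hs : s ≤ t) : I s (ω.stopAt t) = I s ω :=
  (eq_of_measurable_pathFiltration (hI.stronglyAdapted s).measurable fun _ hl =>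
    (stopAt_apply_of_le (hl.trans hs)).symm).symm

theorem stoppedRate_stopAt
    (hτ : IsStoppingTime (pathFiltration T) fun ω => (τ ω : WithTop (Level T)))
    {I : Level T → BeliefPath T → ℝ} (hI : IsStronglyProgressive (pathFiltration T) I)
    (s : Level T) (ω : BeliefPath T) :
    stoppedRate τ I s (ω.stopAt (τ ω)) = stoppedRate τ I s ω := by
  by_cases h : s ≤ τ ω
  · simp [stoppedRate, tau_stopAt hτ, h, rate_stopAt hI h]
  · simp [stoppedRate, tau_stopAt hτ, h]

/-- A stopped dominated right-continuous martingale, read off the stopped paths, is a martingale under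
the law of the stopped paths. -/
theorem martingale_map_stopAt (hT : 0 ≤ T)
    (hτ : IsStoppingTime (pathFiltration T) fun ω => (τ ω : WithTop (Level T)))
    {P : Measure (BeliefPath T)} [IsProbabilityMeasure P] {X Y : Level T → BeliefPath T → ℝ}
    (hX : Martingale X (pathFiltration T) P) {g : BeliefPath T → ℝ} (hg : Integrable g P)
    (hbd : ∀ᵐ ω ∂P, ∀ l, |X l ω| ≤ g ω)
    (hrc : ∀ᵐ ω ∂P, ∀ l, ContinuousWithinAt (fun l => X l ω) (Ici l) l)
    (hY : StronglyAdapted (pathFiltration T) Y)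
    (hXY : ∀ l ω, Y l (ω.stopAt (τ ω)) = X (min (τ ω) l) ω) :
    Martingale Y (pathFiltration T) (P.map fun ω => ω.stopAt (τ ω)) := by
  have hS := measurable_stopAt' hT hτ
  have hprob : IsProbabilityMeasure (P.map fun ω : BeliefPath T => ω.stopAt (τ ω)) :=
    Measure.isProbabilityMeasure_map hS.aemeasurable
  have hYm : ∀ l, StronglyMeasurable (Y l) := fun l => (hY l).mono ((pathFiltration T).le l)
  have hint : ∀ l, Integrable (fun ω => X (min (τ ω) l) ω) P := by
    intro l
    refine hg.mono' ?_ (hbd.mono fun ω h => by simpa using h _)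
    simp only [← hXY]
    exact ((hYm l).comp_measurable hS).aestronglyMeasurable
  have hintY : ∀ l, Integrable (Y l) (P.map fun ω : BeliefPath T => ω.stopAt (τ ω)) := by
    intro l
    rw [integrable_map_measure (hYm l).aestronglyMeasurable hS.aemeasurable]
    simpa only [Function.comp_def, hXY] using hint l
  refine ⟨hY, fun i j hij => (ae_eq_condExp_of_forall_setIntegral_eq ((pathFiltration T).le i)
    (hintY j) (fun _ _ _ => (hintY i).integrableOn) (fun B hB _ => ?_)
    (hY i).aestronglyMeasurable).symm⟩
  have hBm := (pathFiltration T).le i _ hB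
  rw [setIntegral_map hBm (hYm i).aestronglyMeasurable hS.aemeasurable,
    setIntegral_map hBm (hYm j).aestronglyMeasurable hS.aemeasurable]
  simp only [hXY]
  exact (setIntegral_stopped_eq hX hg hbd hrc hτ hij hint (measurable_stopAt hτ i hB)).symm

end Stop

namespace Environment

variable {E : Environment}

instance : MeasurableSingletonClass (BeliefPath E.Lmax) :=
  measurableSingletonClass_beliefPath E.Lmax_pos.le

theorem exists_bound_of_isUncertaintyMeasure {H : ℝ → ℝ} (hH : IsUncertaintyMeasure H) :
    ∃ B, ∀ x ∈ Icc (0 : ℝ) 1, |H x| ≤ B :=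
  isCompact_Icc.exists_bound_of_continuousOn hH.2

theorem stronglyMeasurable_uncertainty {H : ℝ → ℝ} (hH : IsUncertaintyMeasure H)
    (l : Level E.Lmax) :
    StronglyMeasurable[pathFiltration E.Lmax l] fun ω : BeliefPath E.Lmax => H (ω l) := by
  have h1 : Continuous (IccExtend (zero_le_one' ℝ) ((Icc (0 : ℝ) 1).domRestrict H)) :=
    (continuousOn_iff_continuous_domRestrict.1 hH.2).Icc_extend'
  have h2 : (fun ω : BeliefPath E.Lmax => H (ω l)) =
      fun ω => IccExtend (zero_le_one' ℝ) ((Icc (0 : ℝ) 1).domRestrict H) (ω l) := by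
    funext ω
    rw [IccExtend_of_mem _ _ (ω.mem_Icc l)]
    rfl
  rw [h2]
  exact h1.comp_stronglyMeasurable (measurable_coord_pathFiltration le_rfl).stronglyMeasurable

/-- The hypotheses of optional stopping for the Dynkin martingale `H(μ_l) + ∫_0^l I_s ds`. -/
theorem dynkin_dominated {H : ℝ → ℝ} (hH : IsUncertaintyMeasure H)
    {P : Measure (BeliefPath E.Lmax)} [IsProbabilityMeasure P]
    {I : Level E.Lmax → BeliefPath E.Lmax → ℝ} (hI : E.IsLearningRate H P I) :
    ∃ g, Integrable g P ∧
      (∀ᵐ ω ∂P, ∀ l, |H (ω l) + ∫ s in Iic l, I s ω ∂levelMeasure E.Lmax| ≤ g ω) ∧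
      ∀ᵐ ω ∂P, ∀ l, ContinuousWithinAt
        (fun l => H (ω l) + ∫ s in Iic l, I s ω ∂levelMeasure E.Lmax) (Ici l) l := by
  obtain ⟨B, hB⟩ := exists_bound_of_isUncertaintyMeasure hH
  have hae : ∀ᵐ ω ∂P, Integrable (fun s => I s ω) (levelMeasure E.Lmax) :=
    hI.integrable.prod_left_ae
  refine ⟨fun ω => B + ∫ s, ‖I s ω‖ ∂levelMeasure E.Lmax,
    (integrable_const B).add hI.integrable.integral_norm_prod_right, ?_, ?_⟩
  · filter_upwards [hae] with ω hω l
    refine (abs_add_le _ _).trans (add_le_add (hB _ (ω.mem_Icc l)) ?_)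
    rw [← Real.norm_eq_abs]
    exact (norm_integral_le_integral_norm _).trans
      (setIntegral_le_integral hω.norm (Eventually.of_forall fun _ => norm_nonneg _))
  · filter_upwards [hae] with ω hω l
    refine ContinuousWithinAt.add ?_ (continuousWithinAt_setIntegral_Iic hω l)
    exact (hH.2 _ (ω.mem_Icc l)).comp (ω.right_cont l) fun l' _ => ω.mem_Icc l'

theorem abs_belief_le {T : ℝ} (ω : BeliefPath T) (l : Level T) : |ω l| ≤ 1 := by
  rw [abs_of_nonneg (ω.mem_Icc l).1]
  exact (ω.mem_Icc l).2

theorem integral_belief_tau {H : ℝ → ℝ} {σ : Strategy E.Lmax} (hσ : E.Admissible H σ) :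
    ∫ ω, ω (σ.tau ω) ∂σ.law = E.prior := by
  have := hσ.learning.prob
  rw [← hσ.learning.mean]
  exact integral_stopped_eq (X := fun l ω => ω l) hσ.learning.martingale (integrable_const 1)
    (Eventually.of_forall abs_belief_le) (Eventually.of_forall fun ω => ω.right_cont)
    hσ.stopping E.zeroLevel

theorem setIntegral_Iic_zeroLevel (f : Level E.Lmax → ℝ) :
    ∫ s in Iic E.zeroLevel, f s ∂levelMeasure E.Lmax = 0 := by
  have : Iic E.zeroLevel = {E.zeroLevel} := by
    ext s
    simp only [mem_Iic, mem_singleton_iff]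
    exact ⟨fun h => le_antisymm h s.2.1, fun h => h.le⟩
  rw [this, Measure.restrict_eq_zero.2 (levelMeasure_singleton _), integral_zero_measure]

/-- The expected uncertainty reduction is the integral of the learning rate: Dynkin's formula at the
stopping level. -/
theorem dynkin_formula {H : ℝ → ℝ} (hH : IsUncertaintyMeasure H) {σ : Strategy E.Lmax}
    (hσ : E.Admissible H σ) :
    ∫ ω, (H (ω (σ.tau ω)) + ∫ s in Iic (σ.tau ω), σ.rate s ω ∂levelMeasure E.Lmax) ∂σ.law =
      H E.prior := by
  have := hσ.learning.prob
  obtain ⟨g, hg, hbd, hrc⟩ := dynkin_dominated hH hσ.rate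
  rw [integral_stopped_eq
    (X := fun l ω => H (ω l) + ∫ s in Iic l, σ.rate s ω ∂levelMeasure E.Lmax)
    hσ.rate.dynkin hg hbd hrc hσ.stopping E.zeroLevel]
  simp only [setIntegral_Iic_zeroLevel, add_zero]
  exact hσ.rate.start

/-- Learning as `σ` does until `σ.tau` and nothing from then on, with a new stopping level. -/
noncomputable def stopLearning (σ : Strategy E.Lmax) (τ' : BeliefPath E.Lmax → Level E.Lmax) :
    Strategy E.Lmax where
  law := σ.law.map fun ω => ω.stopAt (σ.tau ω)
  rate := stoppedRate σ.tau σ.rate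
  tau := τ'

theorem admissible_stopLearning {H : ℝ → ℝ} (hH : IsUncertaintyMeasure H) {σ : Strategy E.Lmax}
    (hσ : E.Admissible H σ) {τ' : BeliefPath E.Lmax → Level E.Lmax}
    (hτ' : IsStoppingTime (pathFiltration E.Lmax) fun ω => (τ' ω : WithTop (Level E.Lmax))) :
    E.Admissible H (stopLearning σ τ') := by
  have hT := E.Lmax_pos.le
  have hP := hσ.learning.prob
  have hτ := hσ.stopping
  have hS := measurable_stopAt' hT hτ
  have hprog := isStronglyProgressive_stoppedRate hτ hσ.rate.prog
  obtain ⟨g, hg, hbd, hrc⟩ := dynkin_dominated hH hσ.rate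
  have hzero : ∀ ω : BeliefPath E.Lmax, ω.stopAt (σ.tau ω) E.zeroLevel = ω E.zeroLevel :=
    fun ω => stopAt_apply_of_le (σ.tau ω).2.1
  have hrate := stoppedRate_stopAt hτ hσ.rate.prog
  refine ⟨⟨Measure.isProbabilityMeasure_map hS.aemeasurable, ?_, ?_⟩, ⟨hprog, ?_, ?_, ?_⟩, hτ'⟩
  · refine martingale_map_stopAt hT hτ (X := fun l ω => ω l) hσ.learning.martingale
      (integrable_const 1) (Eventually.of_forall abs_belief_le)
      (Eventually.of_forall fun ω => ω.right_cont) hσ.learning.martingale.1 fun l ω => ?_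
    rw [min_comm]
    rfl
  · rw [← hσ.learning.mean]
    refine (integral_map hS.aemeasurable (measurable_coord _).aestronglyMeasurable).trans ?_
    simp only [hzero]
  · have hsm := stronglyMeasurable_rate hT hprog
    have hmap : (levelMeasure E.Lmax).prod (σ.law.map fun ω => ω.stopAt (σ.tau ω)) =
        ((levelMeasure E.Lmax).prod σ.law).map
          (Prod.map id fun ω => ω.stopAt (σ.tau ω)) := by
      rw [← Measure.map_prod_map _ _ measurable_id hS, Measure.map_id]
    change Integrable (fun p : Level E.Lmax × BeliefPath E.Lmax =>
      stoppedRate σ.tau σ.rate p.1 p.2)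
      ((levelMeasure E.Lmax).prod (σ.law.map fun ω => ω.stopAt (σ.tau ω)))
    rw [hmap, integrable_map_measure hsm.aestronglyMeasurable
      (measurable_id.prodMap hS).aemeasurable]
    refine hσ.rate.integrable.mono
      (hsm.comp_measurable (measurable_id.prodMap hS)).aestronglyMeasurable
      (Eventually.of_forall fun p => ?_)
    change ‖stoppedRate σ.tau σ.rate p.1 (p.2.stopAt (σ.tau p.2))‖ ≤ _
    rw [hrate, stoppedRate]
    split_ifs
    · exact le_rfl
    · simp
  · refine martingale_map_stopAt hT hτ hσ.rate.dynkin hg hbd hrc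
      (fun l => (stronglyMeasurable_uncertainty hH l).add
        (stronglyMeasurable_setIntegral_rate hprog l)) fun l ω => ?_
    change H (ω (min l (σ.tau ω))) +
      ∫ s in Iic l, stoppedRate σ.tau σ.rate s (ω.stopAt (σ.tau ω)) ∂_ = _
    simp only [hrate]
    rw [setIntegral_stoppedRate, min_comm]
  · rw [← hσ.rate.start]
    refine (integral_map hS.aemeasurable
      ((stronglyMeasurable_uncertainty hH _).mono
        ((pathFiltration _).le _)).aestronglyMeasurable).trans ?_
    simp only [hzero]

/-! ### No learning -/

/-- The path of a belief that never moves. -/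
def constPath (E : Environment) : BeliefPath E.Lmax where
  toFun _ := E.prior
  mem_Icc _ := E.prior_mem
  right_cont _ := continuousWithinAt_const
  left_lim _ := ⟨E.prior, tendsto_const_nhds⟩

/-- The strategy that learns nothing and stops at the level `t`. -/
noncomputable def noLearning (t : Level E.Lmax) : Strategy E.Lmax where
  law := Measure.dirac E.constPath
  rate _ _ := 0
  tau _ := t

theorem admissible_noLearning {H : ℝ → ℝ} (hH : IsUncertaintyMeasure H) (t : Level E.Lmax) :
    E.Admissible H (noLearning t) := by
  have hmart : ∀ (X : Level E.Lmax → BeliefPath E.Lmax → ℝ) (c : ℝ),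
      StronglyAdapted (pathFiltration E.Lmax) X → (∀ l, X l E.constPath = c) →
      Martingale X (pathFiltration E.Lmax) (Measure.dirac E.constPath) := by
    intro X c hX hc
    have hae : ∀ l, X l =ᵐ[Measure.dirac E.constPath] fun _ => c := by
      intro l
      rw [Filter.EventuallyEq, ae_dirac_eq, eventually_pure]
      exact hc l
    refine ⟨hX, fun i j _ => ?_⟩
    refine (condExp_congr_ae (hae j)).trans ?_
    rw [condExp_const ((pathFiltration _).le i)]
    exact (hae i).symm
  refine ⟨⟨?_, ?_, ?_⟩, ⟨?_, ?_, ?_, ?_⟩, isStoppingTime_const _ _⟩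
  · exact Measure.dirac.isProbabilityMeasure
  · exact hmart _ E.prior
      (fun l => (measurable_coord_pathFiltration le_rfl).stronglyMeasurable) fun l => rfl
  · exact integral_dirac _ _
  · exact isStronglyProgressive_const _ _
  · exact integrable_zero _ _ _
  · refine hmart _ (H E.prior) (fun l => ?_) fun l => ?_
    · simpa [noLearning] using stronglyMeasurable_uncertainty hH l
    · simp [noLearning, constPath]
  · exact integral_dirac _ _

end Environment

/-! ### Payoffs -/

theorem isCompact_argmaxLevel {T : ℝ} (hT : 0 ≤ T) {f : ℝ → ℝ}
    (hf : UpperSemicontinuousOn f (Icc 0 T)) :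
    IsCompact (argmaxLevel T f) ∧ (argmaxLevel T f).Nonempty := by
  obtain ⟨p, hp, hmax⟩ := hf.exists_isMaxOn (nonempty_Icc.2 hT) isCompact_Icc
  refine ⟨?_, p, hp, hmax⟩
  obtain ⟨v, hv, hfv⟩ := upperSemicontinuousOn_iff_preimage_Ici.1 hf (f p)
  have : argmaxLevel T f = Icc 0 T ∩ v := by
    rw [← hfv]
    ext l
    refine and_congr_right fun hl => ⟨fun h => h hp, fun h =>
      isMaxOn_iff.2 fun l' hl' => (isMaxOn_iff.1 hmax l' hl').trans h⟩
  rw [this]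
  exact isCompact_Icc.inter_right hv

theorem SinglePeaked.exists_bound {T : ℝ} {f : ℝ → ℝ} (hf : SinglePeaked T f) :
    ∃ B, ∀ l ∈ Icc 0 T, |f l| ≤ B := by
  obtain ⟨p, hp, hmono, hanti⟩ := hf
  refine ⟨|f p| + |f 0| + |f T|, fun l hl => ?_⟩
  have hpp := abs_le.1 (le_refl |f p|)
  have h0 := abs_le.1 (le_refl |f 0|)
  have hTT := abs_le.1 (le_refl |f T|)
  have n1 := abs_nonneg (f p)
  have n2 := abs_nonneg (f 0)
  have n3 := abs_nonneg (f T)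
  rcases le_total l p with h | h
  · have h1 := hmono ⟨le_rfl, hp.1⟩ ⟨hl.1, h⟩ hl.1
    have h2 := hmono ⟨hl.1, h⟩ ⟨hp.1, le_rfl⟩ h
    exact abs_le.2 ⟨by linarith, by linarith⟩
  · have h1 := hanti ⟨h, hl.2⟩ ⟨hp.2, le_rfl⟩ hl.2
    have h2 := hanti ⟨le_rfl, hp.2⟩ ⟨h, hl.2⟩ h
    exact abs_le.2 ⟨by linarith, by linarith⟩

theorem upperSemicontinuousOn_indirect {T μ : ℝ} (hμ : μ ∈ Icc (0 : ℝ) 1) {w : Bool → ℝ → ℝ}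
    (hw : ∀ θ, UpperSemicontinuousOn (w θ) (Icc 0 T)) :
    UpperSemicontinuousOn (indirect w μ) (Icc 0 T) := by
  have h : ∀ c : ℝ, 0 ≤ c → ∀ θ, UpperSemicontinuousOn (fun l => c * w θ l) (Icc 0 T) :=
    fun c hc θ => (continuous_const_mul c).comp_upperSemicontinuousOn (hw θ)
      fun _ _ h => mul_le_mul_of_nonneg_left h hc
  exact (h μ hμ.1 true).add (h (1 - μ) (by linarith [hμ.2]) false)

theorem upperSemicontinuous_level {T : ℝ} {f : ℝ → ℝ}
    (hf : UpperSemicontinuousOn f (Icc 0 T)) : UpperSemicontinuous fun l : Level T => f l := by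
  intro l y hy
  have h := hf l l.2 y hy
  rw [nhdsWithin_eq_map_subtype_coe l.2] at h
  exact h

theorem measurable_level_of_upperSemicontinuousOn {T : ℝ} {f : ℝ → ℝ}
    (hf : UpperSemicontinuousOn f (Icc 0 T)) : Measurable fun l : Level T => f l :=
  (upperSemicontinuous_level hf).measurable

namespace Environment

variable {E : Environment}

theorem Regular.exists_bound (hE : E.Regular) :
    ∃ B, ∀ θ, ∀ l ∈ Icc 0 E.Lmax, |E.u θ l| ≤ B ∧ |E.v θ l| ≤ B := by
  have h1 : E.U 1 = E.u true := by funext l; simp [U, indirect]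
  have h2 : E.U 0 = E.u false := by funext l; simp [U, indirect]
  have h3 : E.V 1 = E.v true := by funext l; simp [V, indirect]
  have h4 : E.V 0 = E.v false := by funext l; simp [V, indirect]
  obtain ⟨B1, hB1⟩ := (h1 ▸ hE.singlePeaked_U 1 (by simp)).exists_bound
  obtain ⟨B2, hB2⟩ := (h2 ▸ hE.singlePeaked_U 0 (by simp)).exists_bound
  obtain ⟨B3, hB3⟩ := (h3 ▸ hE.singlePeaked_V 1 (by simp)).exists_bound
  obtain ⟨B4, hB4⟩ := (h4 ▸ hE.singlePeaked_V 0 (by simp)).exists_bound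
  refine ⟨max (max B1 B2) (max B3 B4), fun θ l hl => ?_⟩
  cases θ
  · exact ⟨(hB2 l hl).trans (by simp), (hB4 l hl).trans (by simp)⟩
  · exact ⟨(hB1 l hl).trans (by simp), (hB3 l hl).trans (by simp)⟩

theorem Regular.usc_U (hE : E.Regular) {μ : ℝ} (hμ : μ ∈ Icc (0 : ℝ) 1) :
    UpperSemicontinuousOn (E.U μ) (Icc 0 E.Lmax) := upperSemicontinuousOn_indirect hμ hE.usc_u

theorem Regular.usc_V (hE : E.Regular) {μ : ℝ} (hμ : μ ∈ Icc (0 : ℝ) 1) :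
    UpperSemicontinuousOn (E.V μ) (Icc 0 E.Lmax) := upperSemicontinuousOn_indirect hμ hE.usc_v

theorem measurable_indirect {Ω : Type*} [MeasurableSpace Ω] {T : ℝ} {w : Bool → ℝ → ℝ}
    (hw : ∀ θ, UpperSemicontinuousOn (w θ) (Icc 0 T)) {x : Ω → ℝ} (hx : Measurable x)
    {t : Ω → Level T} (ht : Measurable t) : Measurable fun ω => indirect w (x ω) (t ω) := by
  have h := fun θ => (measurable_level_of_upperSemicontinuousOn (hw θ)).comp ht
  exact (hx.mul (h true)).add ((measurable_const.sub hx).mul (h false))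

theorem abs_indirect_le {w : Bool → ℝ → ℝ} {l B : ℝ} (hB : ∀ θ, |w θ l| ≤ B) {μ : ℝ}
    (hμ : μ ∈ Icc (0 : ℝ) 1) : |indirect w μ l| ≤ B := by
  have h1 := abs_le.1 (hB true)
  have h2 := abs_le.1 (hB false)
  have := hμ.1
  have := hμ.2
  rw [indirect, abs_le]
  constructor <;> nlinarith

theorem indirect_le_add_abs {w : Bool → ℝ → ℝ} {l B : ℝ} (hB : ∀ θ, |w θ l| ≤ B) (μ m : ℝ) :
    indirect w μ l ≤ indirect w m l + 2 * B * |μ - m| := by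
  have h : indirect w μ l - indirect w m l = (μ - m) * (w true l - w false l) := by
    simp only [indirect]; ring
  have h2 : |w true l - w false l| ≤ 2 * B :=
    (abs_sub _ _).trans (by linarith [hB true, hB false])
  have h3 : (μ - m) * (w true l - w false l) ≤ |μ - m| * (2 * B) :=
    (le_abs_self _).trans (by rw [abs_mul]; exact mul_le_mul_of_nonneg_left h2 (abs_nonneg _))
  linarith

/-! ### The quota and the tax -/

theorem Lstar_mem (hE : E.Regular) : E.Lstar ∈ argmaxLevel E.Lmax
    fun l => (E.U E.prior l - E.U E.prior 0) + E.V E.prior l := by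
  have h1 : UpperSemicontinuousOn (fun l => E.U E.prior l + -E.U E.prior 0 + E.V E.prior l)
      (Icc 0 E.Lmax) :=
    ((hE.usc_U E.prior_mem).add continuousOn_const.upperSemicontinuousOn).add
      (hE.usc_V E.prior_mem)
  obtain ⟨hc, hn⟩ := isCompact_argmaxLevel E.Lmax_pos.le h1
  exact hc.sInf_mem hn

/-- The level `L*` as an element of the space of levels. -/
noncomputable def quota (hE : E.Regular) : Level E.Lmax := ⟨E.Lstar, (Lstar_mem hE).1⟩

theorem surplus_le (hE : E.Regular) {l : ℝ} (hl : l ∈ Icc 0 E.Lmax) :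
    E.U E.prior l + E.V E.prior l ≤
      E.V E.prior E.Lstar + E.taxStar + E.U E.prior 0 := by
  have h : E.U E.prior l - E.U E.prior 0 + E.V E.prior l ≤
      E.U E.prior E.Lstar - E.U E.prior 0 + E.V E.prior E.Lstar := (Lstar_mem hE).2 hl
  rw [taxStar]
  linarith

theorem isMechanism_quotaTax (L tax : ℝ) : E.IsMechanism (E.quotaTax L tax) := by
  refine lowerSemicontinuous_iff_isClosed_preimage.2 fun y => ?_
  have hL : IsClosed {l : Level E.Lmax | (l : ℝ) ≤ L} :=
    isClosed_le continuous_subtype_val continuous_const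
  rcases eq_or_ne y ⊤ with rfl | hy
  · simp
  by_cases h : (tax : EReal) ≤ y
  · convert hL using 1
    ext l
    by_cases hl : (l : ℝ) ≤ L <;> simp [quotaTax, hl, h, hy]
  · convert isClosed_empty using 1
    ext l
    by_cases hl : (l : ℝ) ≤ L <;> simp [quotaTax, hl, hy, not_le.1 h]

theorem agentPayoff_noLearning (φ : Level E.Lmax → EReal) {C : ℝ → EReal} (hC : C 0 = 0)
    (t : Level E.Lmax) :
    E.agentPayoff φ C (noLearning t) = (E.U E.prior t : EReal) - φ t := by
  rw [agentPayoff, noLearning, extExpectation_dirac]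
  simp [hC, constPath]

/-- An upper semicontinuous objective on the levels has a largest maximizer. -/
theorem exists_greatest_max (hE : E.Regular) {φ : Level E.Lmax → EReal} (hφ : E.IsMechanism φ) :
    ∃ t : Level E.Lmax,
      (∀ l : Level E.Lmax, (E.U E.prior l : EReal) - φ l ≤ (E.U E.prior t : EReal) - φ t) ∧
      ∀ l : Level E.Lmax, (E.U E.prior t : EReal) - φ t ≤ (E.U E.prior l : EReal) - φ l →
        l ≤ t := by
  have hne : Nonempty (Level E.Lmax) := ⟨E.zeroLevel⟩
  have h1 : UpperSemicontinuous fun l : Level E.Lmax => ((E.U E.prior l : ℝ) : EReal) :=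
    continuous_coe_real_ereal.comp_upperSemicontinuous
      (upperSemicontinuous_level (hE.usc_U E.prior_mem))
      EReal.coe_strictMono.monotone
  have h2 : UpperSemicontinuous fun l => -φ l :=
    continuous_neg.comp_lowerSemicontinuous_antitone hφ fun _ _ h => EReal.neg_le_neg_iff.2 h
  have h3 : UpperSemicontinuous fun l : Level E.Lmax => ((E.U E.prior l : ℝ) : EReal) - φ l := by
    simp only [sub_eq_add_neg]
    exact h1.add' h2 fun l => EReal.continuousAt_add (by simp) (by simp)
  obtain ⟨p, -, hp⟩ := (h3.upperSemicontinuousOn univ).exists_isMaxOn univ_nonempty isCompact_univ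
  have hcl : IsClosed {l : Level E.Lmax | (E.U E.prior p : EReal) - φ p ≤
      (E.U E.prior l : EReal) - φ l} :=
    upperSemicontinuous_iff_isClosed_preimage.1 h3 ((E.U E.prior p : EReal) - φ p)
  obtain ⟨t, ht, hgr⟩ := hcl.isCompact.exists_isGreatest ⟨p, mem_ofPred_eq.symm ▸ le_rfl⟩
  exact ⟨t, fun l => (hp (mem_univ l)).trans ht, fun l hl => hgr (ht.trans hl)⟩

/-! ### Costs that deter learning -/

/-- The linear cost of uncertainty reduction with marginal cost `K`. -/
def linearCost (K x : ℝ) : EReal := ((K * x : ℝ) : EReal)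

/-- The uncertainty measure `-|μ - m|`. Its kink at `m` makes the expected uncertainty reduction of a
belief with mean `m` equal to its mean absolute deviation. -/
def kinkedUncertainty (m μ : ℝ) : ℝ := -|μ - m|

theorem isUncertaintyMeasure_kinked (m : ℝ) : IsUncertaintyMeasure (kinkedUncertainty m) := by
  refine ⟨⟨convex_Icc 0 1, fun x _ y _ a b ha hb hab => ?_⟩, ?_⟩
  · have h : a * x + b * y - m = a * (x - m) + b * (y - m) := by
      linear_combination m * hab
    simp only [kinkedUncertainty, smul_eq_mul, h]
    have h2 := abs_add_le (a * (x - m)) (b * (y - m))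
    rw [abs_mul, abs_mul, abs_of_nonneg ha, abs_of_nonneg hb] at h2
    linarith
  · unfold kinkedUncertainty
    fun_prop

theorem linearCost_mem_realPairs {K : ℝ} (hK : 0 ≤ K) (m : ℝ) :
    (linearCost K, kinkedUncertainty m) ∈ realPairs := by
  refine ⟨⟨⟨fun x y h => ?_, by simp [linearCost], fun x => EReal.coe_ne_bot _⟩,
    isUncertaintyMeasure_kinked m⟩, fun x => EReal.coe_ne_top _⟩
  exact EReal.coe_le_coe_iff.2 (mul_le_mul_of_nonneg_left h hK)

theorem integral_le_lintegral_ofReal {α : Type*} [MeasurableSpace α] {μ : Measure α} (f : α → ℝ) :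
    ((∫ x, f x ∂μ : ℝ) : EReal) ≤ ((∫⁻ x, ENNReal.ofReal (f x) ∂μ : ℝ≥0∞) : EReal) := by
  by_cases hf : Integrable f μ
  · rw [integral_eq_lintegral_pos_part_sub_lintegral_neg_part hf,
      ← EReal.coe_ennreal_toReal hf.lintegral_lt_top.ne, EReal.coe_le_coe_iff]
    exact sub_le_self _ ENNReal.toReal_nonneg
  · rw [integral_undef hf]
    exact EReal.coe_ennreal_nonneg _

theorem linearCost_le (K : ℝ) {σ : Strategy E.Lmax} (ω : BeliefPath E.Lmax) :
    ((K * ∫ s in Iic (σ.tau ω), σ.rate s ω ∂levelMeasure E.Lmax : ℝ) : EReal) ≤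
      ((∫⁻ s in Iic (σ.tau ω), (linearCost K (σ.rate s ω)).toENNReal ∂levelMeasure E.Lmax :
        ℝ≥0∞) : EReal) := by
  rw [← integral_const_mul]
  exact integral_le_lintegral_ofReal _

theorem measurable_belief_tau {σ : Strategy E.Lmax} {H : ℝ → ℝ} (hσ : E.Admissible H σ) :
    Measurable fun ω : BeliefPath E.Lmax => ω (σ.tau ω) :=
  (measurable_eval E.Lmax_pos.le).comp
    ((measurable_of_isStoppingTime E.Lmax_pos.le hσ.stopping).prodMk measurable_id)

theorem measurable_integral_rate {σ : Strategy E.Lmax} {H : ℝ → ℝ} (hσ : E.Admissible H σ) :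
    Measurable fun ω => ∫ s in Iic (σ.tau ω), σ.rate s ω ∂levelMeasure E.Lmax := by
  have h := ((stronglyMeasurable_setIntegral_rate
    (isStronglyProgressive_stoppedRate hσ.stopping hσ.rate.prog)
    ⟨E.Lmax, E.Lmax_pos.le, le_rfl⟩).mono ((pathFiltration _).le _)).measurable
  simp only [setIntegral_stoppedRate] at h
  convert h using 5 with ω
  exact (min_eq_left (show σ.tau ω ≤ ⟨E.Lmax, _⟩ from (σ.tau ω).2.2)).symm

theorem integrable_integral_rate {σ : Strategy E.Lmax} {H : ℝ → ℝ} (hσ : E.Admissible H σ) :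
    Integrable (fun ω => ∫ s in Iic (σ.tau ω), σ.rate s ω ∂levelMeasure E.Lmax) σ.law := by
  have := hσ.learning.prob
  refine hσ.rate.integrable.integral_norm_prod_right.mono'
    (measurable_integral_rate hσ).aestronglyMeasurable ?_
  filter_upwards [hσ.rate.integrable.prod_left_ae] with ω hω
  exact (norm_integral_le_integral_norm _).trans
    (setIntegral_le_integral hω.norm (Eventually.of_forall fun _ => norm_nonneg _))

theorem integrable_deviation {σ : Strategy E.Lmax} {H : ℝ → ℝ} (hσ : E.Admissible H σ) :
    Integrable (fun ω => |ω (σ.tau ω) - E.prior|) σ.law := by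
  have := hσ.learning.prob
  refine (integrable_const (2 : ℝ)).mono'
    (((measurable_belief_tau hσ).sub_const _).abs).aestronglyMeasurable
    (Eventually.of_forall fun ω => ?_)
  have h1 := ω.mem_Icc (σ.tau ω)
  have h2 := E.prior_mem
  rw [Real.norm_eq_abs, abs_abs, abs_le]
  constructor <;> linarith [h1.1, h1.2, h2.1, h2.2]

/-- What remains of the gain `K |μ_τ - μ_0|` from learning after paying for it. -/
noncomputable def learningGain (K : ℝ) (σ : Strategy E.Lmax) (ω : BeliefPath E.Lmax) : ℝ :=
  K * |ω (σ.tau ω) - E.prior| - K * ∫ s in Iic (σ.tau ω), σ.rate s ω ∂levelMeasure E.Lmax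

theorem integrable_learningGain (K : ℝ) {σ : Strategy E.Lmax} {H : ℝ → ℝ}
    (hσ : E.Admissible H σ) : Integrable (learningGain K σ) σ.law :=
  ((integrable_deviation hσ).const_mul K).sub ((integrable_integral_rate hσ).const_mul K)

theorem integral_learningGain (K : ℝ) {σ : Strategy E.Lmax}
    (hσ : E.Admissible (kinkedUncertainty E.prior) σ) : ∫ ω, learningGain K σ ω ∂σ.law = 0 := by
  have h := dynkin_formula (isUncertaintyMeasure_kinked _) hσ
  have h2 : learningGain K σ = fun ω => -K * (kinkedUncertainty E.prior (ω (σ.tau ω)) +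
      ∫ s in Iic (σ.tau ω), σ.rate s ω ∂levelMeasure E.Lmax) := by
    funext ω
    simp only [learningGain, kinkedUncertainty]
    ring
  rw [h2, integral_const_mul, h]
  simp [kinkedUncertainty]

/-- The agent's payoff with the cost replaced by the pathwise integral `K ∫_0^τ I_s ds`. -/
noncomputable def linearPayoff (φ : Level E.Lmax → EReal) (K : ℝ) (σ : Strategy E.Lmax)
    (ω : BeliefPath E.Lmax) : EReal :=
  (E.U (ω (σ.tau ω)) (σ.tau ω) : EReal) - φ (σ.tau ω) -
    ((K * ∫ s in Iic (σ.tau ω), σ.rate s ω ∂levelMeasure E.Lmax : ℝ) : EReal)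

theorem agentPayoff_le_linearPayoff (φ : Level E.Lmax → EReal) (K : ℝ) (σ : Strategy E.Lmax) :
    E.agentPayoff φ (linearCost K) σ ≤ extExpectation σ.law (linearPayoff φ K σ) :=
  extExpectation_mono (Eventually.of_forall fun ω => EReal.sub_le_sub le_rfl (linearCost_le K ω))

theorem measurable_linearPayoff (hE : E.Regular) {φ : Level E.Lmax → EReal}
    (hφ : E.IsMechanism φ) (K : ℝ) {σ : Strategy E.Lmax} {H : ℝ → ℝ} (hσ : E.Admissible H σ) :
    Measurable (linearPayoff φ K σ) := by
  have hτ := measurable_of_isStoppingTime E.Lmax_pos.le hσ.stopping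
  have h1 : Measurable fun ω : BeliefPath E.Lmax => E.U (ω (σ.tau ω)) (σ.tau ω) :=
    measurable_indirect hE.usc_u (measurable_belief_tau hσ) hτ
  have h2 : Measurable fun ω => φ (σ.tau ω) := (LowerSemicontinuous.measurable hφ).comp hτ
  have h3 := (measurable_integral_rate hσ).const_mul K
  unfold linearPayoff
  simp only [sub_eq_add_neg]
  exact (h1.coe_real_ereal.add h2.neg).add h3.coe_real_ereal.neg

theorem linearPayoff_le {B K : ℝ} (hB : ∀ θ, ∀ l ∈ Icc 0 E.Lmax, |E.u θ l| ≤ B ∧ |E.v θ l| ≤ B)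
    (hK : 2 * B ≤ K) {φ : Level E.Lmax → EReal} {a : ℝ}
    (ha : ∀ l : Level E.Lmax, (E.U E.prior l : EReal) - φ l ≤ a) (σ : Strategy E.Lmax)
    (ω : BeliefPath E.Lmax) :
    linearPayoff φ K σ ω ≤ ((a + learningGain K σ ω : ℝ) : EReal) := by
  have h1 : E.U (ω (σ.tau ω)) (σ.tau ω) ≤
      E.U E.prior (σ.tau ω) + 2 * B * |ω (σ.tau ω) - E.prior| :=
    indirect_le_add_abs (fun θ => (hB θ _ (σ.tau ω).2).1) _ _
  have h2 : 2 * B * |ω (σ.tau ω) - E.prior| ≤ K * |ω (σ.tau ω) - E.prior| :=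
    mul_le_mul_of_nonneg_right hK (abs_nonneg _)
  have h3 := ha (σ.tau ω)
  rw [linearPayoff, learningGain]
  generalize φ (σ.tau ω) = y at h3 ⊢
  induction y with
  | bot => simp at h3
  | top => simp
  | coe p =>
    norm_cast at h3 ⊢
    linarith

theorem agentPayoff_linearCost_le {B K : ℝ}
    (hB : ∀ θ, ∀ l ∈ Icc 0 E.Lmax, |E.u θ l| ≤ B ∧ |E.v θ l| ≤ B)
    (hK : 2 * B ≤ K) {φ : Level E.Lmax → EReal} {a : ℝ}
    (ha : ∀ l : Level E.Lmax, (E.U E.prior l : EReal) - φ l ≤ a) {σ : Strategy E.Lmax}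
    (hσ : E.Admissible (kinkedUncertainty E.prior) σ) :
    E.agentPayoff φ (linearCost K) σ ≤ a := by
  have := hσ.learning.prob
  have hg := integrable_learningGain K hσ
  calc E.agentPayoff φ (linearCost K) σ ≤ extExpectation σ.law (linearPayoff φ K σ) :=
        agentPayoff_le_linearPayoff φ K σ
    _ ≤ extExpectation σ.law fun ω => ((a + learningGain K σ ω : ℝ) : EReal) :=
        extExpectation_mono (Eventually.of_forall (linearPayoff_le hB hK ha σ))
    _ = a := by
        rw [extExpectation_coe (r := fun ω => a + learningGain K σ ω) ((integrable_const a).add hg),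
          integral_add (integrable_const a) hg, integral_learningGain K hσ]
        simp

/-- When learning does not pay, the principal gets at most the joint surplus net of what the agent
must be left with. -/
theorem principalPayoff_linearCost_le (hE : E.Regular) {B K : ℝ}
    (hB : ∀ θ, ∀ l ∈ Icc 0 E.Lmax, |E.u θ l| ≤ B ∧ |E.v θ l| ≤ B)
    (hK : 4 * B ≤ K) (hB0 : 0 ≤ B) {φ : Level E.Lmax → EReal} (hφ : E.IsMechanism φ) {a : ℝ}
    (ha : ∀ l : Level E.Lmax, (E.U E.prior l : EReal) - φ l ≤ a) {σ : Strategy E.Lmax}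
    (hσ : E.Admissible (kinkedUncertainty E.prior) σ)
    (hpay : (a : EReal) ≤ E.agentPayoff φ (linearCost K) σ) :
    E.principalPayoff φ (some σ) ≤
      ((E.V E.prior E.Lstar + E.taxStar + E.U E.prior 0 - a : ℝ) : EReal) := by
  have := hσ.learning.prob
  have hg := integrable_learningGain K hσ
  have hle := extExpectation_le_sub (P := σ.law) (f := linearPayoff φ K σ)
    (g := fun ω => (E.V (ω (σ.tau ω)) (σ.tau ω) : EReal) + φ (σ.tau ω))
    (r := fun ω => a + learningGain K σ ω)
    (R := fun ω => (E.V E.prior E.Lstar + E.taxStar + E.U E.prior 0) + learningGain K σ ω)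
    (measurable_linearPayoff hE hφ K hσ).aemeasurable
    ((integrable_const a).add hg) ((integrable_const _).add hg)
    (Eventually.of_forall (linearPayoff_le hB (by linarith) ha σ))
    (Eventually.of_forall fun ω => ?_)
    (hpay.trans (agentPayoff_le_linearPayoff φ K σ))
  · rw [integral_add (integrable_const _) hg, integral_learningGain K hσ] at hle
    simpa [principalPayoff] using hle
  · have h1 : E.U (ω (σ.tau ω)) (σ.tau ω) ≤
        E.U E.prior (σ.tau ω) + 2 * B * |ω (σ.tau ω) - E.prior| :=
      indirect_le_add_abs (fun θ => (hB θ _ (σ.tau ω).2).1) _ _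
    have h2 : E.V (ω (σ.tau ω)) (σ.tau ω) ≤
        E.V E.prior (σ.tau ω) + 2 * B * |ω (σ.tau ω) - E.prior| :=
      indirect_le_add_abs (fun θ => (hB θ _ (σ.tau ω).2).2) _ _
    have h3 : 4 * B * |ω (σ.tau ω) - E.prior| ≤ K * |ω (σ.tau ω) - E.prior| :=
      mul_le_mul_of_nonneg_right hK (abs_nonneg _)
    have h4 := surplus_le hE (σ.tau ω).2
    simp only [linearPayoff, learningGain]
    induction φ (σ.tau ω) with
    | bot => simp
    | top =>
      rw [EReal.sub_top, EReal.bot_sub, EReal.coe_sub_bot]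
      exact le_top
    | coe p =>
      norm_cast
      linarith

/-- A mechanism that gives the agent an infinite payoff costs the principal an infinite amount. -/
theorem principalPayoff_eq_bot {B : ℝ}
    (hB : ∀ θ, ∀ l ∈ Icc 0 E.Lmax, |E.u θ l| ≤ B ∧ |E.v θ l| ≤ B) {φ : Level E.Lmax → EReal}
    {C : ℝ → EReal} {H : ℝ → ℝ} {σ : Strategy E.Lmax} (hσ : E.Admissible H σ)
    (hpay : E.agentPayoff φ C σ = ⊤) : E.principalPayoff φ (some σ) = ⊥ := by
  have := hσ.learning.prob
  refine extExpectation_eq_bot (N := 2 * B) (fun ω => ?_) hpay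
  have h1 : |E.U (ω (σ.tau ω)) (σ.tau ω)| ≤ B :=
    abs_indirect_le (fun θ => (hB θ _ (σ.tau ω).2).1) (ω.mem_Icc _)
  have h2 : |E.V (ω (σ.tau ω)) (σ.tau ω)| ≤ B :=
    abs_indirect_le (fun θ => (hB θ _ (σ.tau ω).2).2) (ω.mem_Icc _)
  have h3 := abs_le.1 h1
  have h4 := abs_le.1 h2
  refine (EReal.sub_le_sub le_rfl (EReal.coe_ennreal_nonneg _)).trans ?_
  rw [sub_zero]
  induction φ (σ.tau ω) with
  | bot =>
    rw [EReal.add_bot, EReal.neg_bot, EReal.coe_add_top]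
    exact le_top
  | top => simp
  | coe p =>
    norm_cast
    linarith

/-- Stopping at the largest maximizer without learning is a best response when learning does not
pay and the agent participates. -/
theorem isBestResponse_noLearning {φ : Level E.Lmax → EReal} {C : ℝ → EReal} {H : ℝ → ℝ}
    (hC : C 0 = 0) (hH : IsUncertaintyMeasure H) {t : Level E.Lmax}
    (ht : ∀ l : Level E.Lmax, (E.U E.prior t : EReal) - φ t ≤ (E.U E.prior l : EReal) - φ l →
      l ≤ t)
    (hpart : (E.U E.prior 0 : EReal) ≤ (E.U E.prior t : EReal) - φ t)
    (hopt : ∀ σ, E.Admissible H σ → E.agentPayoff φ C σ ≤ (E.U E.prior t : EReal) - φ t) :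
    E.IsBestResponse φ C H (some (noLearning t)) := by
  have hpay := agentPayoff_noLearning φ hC t
  refine ⟨admissible_noLearning hH t, hpart.trans_eq hpay.symm,
    fun σ hσ => (hopt σ hσ).trans_eq hpay.symm, fun σ' _ hlaw hle heq => ?_⟩
  have hS := measurable_stopAt' E.Lmax_pos.le (admissible_noLearning hH t).stopping
  have hlaw' : σ'.law = Measure.dirac E.constPath := by
    rw [hlaw]
    exact Measure.map_dirac' hS _
  -- The law is a point mass, so the competing stopping level is a single number, again a maximizer.
  rw [hlaw', ae_dirac_eq, eventually_pure] at hle ⊢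
  refine le_antisymm (ht _ ?_) hle
  rw [← hpay, ← heq, agentPayoff, hlaw', extExpectation_dirac]
  refine (EReal.sub_le_sub le_rfl (EReal.coe_ennreal_nonneg _)).trans ?_
  rw [sub_zero]
  exact le_rfl

/-- For every mechanism there is a cost, so high that the agent learns nothing, at which the principal
gets no more than the joint surplus at `L*` under the prior. -/
theorem exists_pair_principalPayoff_le (hE : E.Regular) {φ : Level E.Lmax → EReal}
    (hφ : E.IsMechanism φ) :
    ∃ e ∈ realPairs, (∃ r, E.IsBestResponse φ e.1 e.2 r) ∧
      ∀ r, E.IsBestResponse φ e.1 e.2 r →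
        E.principalPayoff φ r ≤ ((E.V E.prior E.Lstar + E.taxStar : ℝ) : EReal) := by
  obtain ⟨B, hB⟩ := hE.exists_bound
  have hB0 : 0 ≤ B := (abs_nonneg _).trans (hB true 0 ⟨le_rfl, E.Lmax_pos.le⟩).1
  obtain ⟨t, hmax, hgr⟩ := exists_greatest_max hE hφ
  have hC : linearCost (4 * B) 0 = 0 := by simp [linearCost]
  have hH := isUncertaintyMeasure_kinked E.prior
  -- `U + V` is `4 * B`-Lipschitz in the belief, so at this marginal cost learning cannot create surplus.
  refine ⟨(linearCost (4 * B), kinkedUncertainty E.prior),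
    linearCost_mem_realPairs (by positivity) _, ?_⟩
  have hle : ∀ a : ℝ, (E.U E.prior t : EReal) - φ t ≤ a →
      ∀ σ, E.Admissible (kinkedUncertainty E.prior) σ →
        E.agentPayoff φ (linearCost (4 * B)) σ ≤ a :=
    fun a ha σ hσ => agentPayoff_linearCost_le hB (by linarith) (fun l => (hmax l).trans ha) hσ
  rcases lt_or_ge ((E.U E.prior t : EReal) - φ t) (E.U E.prior 0 : EReal) with hlt | hge
  · -- The maximum may be `-∞`; a real number below the outside option bounds all payoffs.
    obtain ⟨a, ha, ha0⟩ := EReal.lt_iff_exists_real_btwn.1 hlt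
    have hout : ∀ σ, E.Admissible (kinkedUncertainty E.prior) σ →
        E.agentPayoff φ (linearCost (4 * B)) σ < (E.U E.prior 0 : EReal) :=
      fun σ hσ => (hle a ha.le σ hσ).trans_lt ha0
    refine ⟨⟨none, hout⟩, fun r hr => ?_⟩
    cases r with
    | none =>
      have h := surplus_le hE (l := 0) ⟨le_rfl, E.Lmax_pos.le⟩
      exact EReal.coe_le_coe_iff.2 (by linarith)
    | some σ => exact absurd hr.2.1 (hout σ hr.1).not_ge
  · have hopt : ∀ σ, E.Admissible (kinkedUncertainty E.prior) σ →
        E.agentPayoff φ (linearCost (4 * B)) σ ≤ (E.U E.prior t : EReal) - φ t := by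
      intro σ hσ
      refine EReal.le_of_forall_lt_iff_le.1 fun a ha => hle a ha.le σ hσ
    refine ⟨⟨_, isBestResponse_noLearning hC hH hgr hge hopt⟩, fun r hr => ?_⟩
    have hno := agentPayoff_noLearning φ hC t
    cases r with
    | none => exact absurd (hr _ (admissible_noLearning hH t)) (by rw [hno]; exact hge.not_gt)
    | some σ =>
      have hσt := hr.2.2.1 _ (admissible_noLearning hH t)
      rw [hno] at hσt
      generalize hA : (E.U E.prior t : EReal) - φ t = A at *
      induction A with
      | bot => simp at hge
      | top =>
        rw [principalPayoff_eq_bot hB hr.1 (top_le_iff.1 hσt)]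
        exact bot_le
      | coe a =>
        refine (principalPayoff_linearCost_le hE hB le_rfl hB0 hφ hmax hr.1 hσt).trans ?_
        rw [EReal.coe_le_coe_iff] at hge ⊢
        linarith

end Environment

/-! ### Single-peaked payoffs and waiting -/

theorem SinglePeaked.le_of_le_sSup {T : ℝ} (hT : 0 ≤ T) {f : ℝ → ℝ} (hf : SinglePeaked T f)
    (husc : UpperSemicontinuousOn f (Icc 0 T)) {l l' : ℝ} (hl : 0 ≤ l) (hll' : l ≤ l')
    (hl' : l' ≤ sSup (argmaxLevel T f)) : f l ≤ f l' := by
  obtain ⟨p, hp, hmono, hanti⟩ := hf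
  obtain ⟨hc, hn⟩ := isCompact_argmaxLevel hT husc
  obtain ⟨hmem, hmax⟩ := hc.sSup_mem hn
  rcases le_total l' p with h | h
  · exact hmono ⟨hl, hll'.trans h⟩ ⟨hl.trans hll', h⟩ hll'
  · exact (isMaxOn_iff.1 hmax l ⟨hl, (hll'.trans hl').trans hmem.2⟩).trans
      (hanti ⟨h, hl'.trans hmem.2⟩ ⟨h.trans hl', hmem.2⟩ hl')

theorem SinglePeaked.le_of_sSup_le {T : ℝ} {f : ℝ → ℝ} (hf : SinglePeaked T f) {l l' : ℝ}
    (hl : sSup (argmaxLevel T f) ≤ l) (hll' : l ≤ l') (hl' : l' ≤ T) : f l' ≤ f l := by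
  obtain ⟨p, hp, hmono, hanti⟩ := hf
  have hpm : p ∈ argmaxLevel T f := by
    refine ⟨hp, isMaxOn_iff.2 fun x hx => ?_⟩
    rcases le_total x p with h | h
    · exact hmono ⟨hx.1, h⟩ ⟨hp.1, le_rfl⟩ h
    · exact hanti ⟨le_rfl, hp.2⟩ ⟨h, hx.2⟩ h
  have hpl : p ≤ l := (le_csSup ⟨T, fun x hx => hx.1.2⟩ hpm).trans hl
  exact hanti ⟨hpl, hll'.trans hl'⟩ ⟨hpl.trans hll', hl'⟩ hll'

namespace Environment

variable {E : Environment}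

/-- The level `min (l̂_U(μ)) L*` up to which the agent is willing to go under the quota when she
learns nothing more. -/
noncomputable def waitLevel (hE : E.Regular) (μ : ℝ) : Level E.Lmax :=
  min (projIcc 0 E.Lmax E.Lmax_pos.le (E.peakU (projIcc 0 1 zero_le_one μ))) (quota hE)

theorem measurable_waitLevel (hE : E.Regular) : Measurable (waitLevel hE) := by
  have h : Continuous fun μ : ℝ => E.peakU (projIcc 0 1 zero_le_one μ) :=
    (continuousOn_iff_continuous_domRestrict.1 hE.continuous_peakU).comp continuous_projIcc
  exact ((continuous_projIcc.comp h).min continuous_const).measurable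

theorem coe_waitLevel (hE : E.Regular) {μ : ℝ} (hμ : μ ∈ Icc (0 : ℝ) 1) :
    (waitLevel hE μ : ℝ) = min (E.peakU μ) E.Lstar := by
  obtain ⟨hc, hn⟩ := isCompact_argmaxLevel E.Lmax_pos.le (hE.usc_U hμ)
  have hpeak : E.peakU μ ∈ Icc 0 E.Lmax := (hc.sSup_mem hn).1
  have h1 : ((projIcc 0 1 zero_le_one μ : Icc (0 : ℝ) 1) : ℝ) = μ := by
    rw [projIcc_of_mem zero_le_one hμ]
  have h2 : ((projIcc 0 E.Lmax E.Lmax_pos.le (E.peakU μ) : Level E.Lmax) : ℝ) = E.peakU μ := by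
    rw [projIcc_of_mem E.Lmax_pos.le hpeak]
  rw [waitLevel, h1]
  change min ((projIcc 0 E.Lmax E.Lmax_pos.le (E.peakU μ) : Level E.Lmax) : ℝ) E.Lstar = _
  rw [h2]

/-- Waiting after the stopping level `τ`, without further learning, until the level preferred at the
belief `μ_τ` or the quota is reached. -/
noncomputable def waitTau (hE : E.Regular) (τ : BeliefPath E.Lmax → Level E.Lmax)
    (ω : BeliefPath E.Lmax) : Level E.Lmax := max (τ ω) (waitLevel hE (ω (τ ω)))

theorem isStoppingTime_waitTau (hE : E.Regular) {τ : BeliefPath E.Lmax → Level E.Lmax}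
    (hτ : IsStoppingTime (pathFiltration E.Lmax) fun ω => (τ ω : WithTop (Level E.Lmax))) :
    IsStoppingTime (pathFiltration E.Lmax)
      fun ω => (waitTau hE τ ω : WithTop (Level E.Lmax)) := by
  refine isStoppingTime_coe fun i => ?_
  -- On `{τ ≤ i}` the belief at `τ` is the belief at `τ ∧ i`, which is known at level `i`.
  have h : {ω | waitTau hE τ ω ≤ i} =
      {ω | τ ω ≤ i} ∩ {ω | waitLevel hE (ω (min (min (τ ω) i) i)) ≤ i} := by
    ext ω
    simp only [waitTau, max_le_iff, mem_ofPred_eq, mem_inter_iff]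
    refine and_congr_right fun h => ?_
    rw [min_eq_left h, min_eq_left h]
  rw [h]
  refine (measurableSet_le_of_isStoppingTime hτ i).inter ?_
  let _ : MeasurableSpace (BeliefPath E.Lmax) := pathFiltration E.Lmax i
  have hm : Measurable fun ω : BeliefPath E.Lmax => (min (τ ω) i, ω) :=
    (measurable_min_of_isStoppingTime hτ i).prodMk measurable_id
  exact ((measurable_waitLevel hE).comp ((measurable_eval_pathFiltration i).comp hm))
    measurableSet_Iic

theorem measurable_agentPayoff_integrand (hE : E.Regular) {φ : Level E.Lmax → EReal}
    (hφ : E.IsMechanism φ) {C : ℝ → EReal} (hC : IsCost C) {H : ℝ → ℝ} {σ : Strategy E.Lmax}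
    (hσ : E.Admissible H σ) :
    Measurable fun ω => (E.U (ω (σ.tau ω)) (σ.tau ω) : EReal) - φ (σ.tau ω)
      - ((∫⁻ s in Iic (σ.tau ω), (C (σ.rate s ω)).toENNReal ∂levelMeasure E.Lmax : ℝ≥0∞) :
        EReal) := by
  have hτ := measurable_of_isStoppingTime E.Lmax_pos.le hσ.stopping
  have h1 : Measurable fun ω : BeliefPath E.Lmax => E.U (ω (σ.tau ω)) (σ.tau ω) :=
    measurable_indirect hE.usc_u (measurable_belief_tau hσ) hτ
  have h2 : Measurable fun ω => φ (σ.tau ω) := (LowerSemicontinuous.measurable hφ).comp hτ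
  have h3 : Measurable fun p : Level E.Lmax × BeliefPath E.Lmax =>
      {p : Level E.Lmax × BeliefPath E.Lmax | p.1 ≤ σ.tau p.2}.indicator
        (fun p => (C (σ.rate p.1 p.2)).toENNReal) p :=
    (hC.1.measurable.comp
      (stronglyMeasurable_rate E.Lmax_pos.le hσ.rate.prog).measurable).ereal_toENNReal.indicator
      (measurableSet_le measurable_fst (hτ.comp measurable_snd))
  have h4 : Measurable fun ω => ∫⁻ s in Iic (σ.tau ω), (C (σ.rate s ω)).toENNReal
      ∂levelMeasure E.Lmax := by
    convert h3.lintegral_prod_left' (μ := levelMeasure E.Lmax) using 2 with ω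
    rw [← lintegral_indicator measurableSet_Iic]
    rfl
  simp only [sub_eq_add_neg]
  exact (h1.coe_real_ereal.add h2.neg).add h4.coe_ereal_ennreal.neg

theorem lintegral_cost_stopAt {C : ℝ → EReal} (hC : C 0 = 0) {H : ℝ → ℝ} {σ : Strategy E.Lmax}
    (hσ : E.Admissible H σ) (ω : BeliefPath E.Lmax) {t : Level E.Lmax} (ht : σ.tau ω ≤ t) :
    ∫⁻ s in Iic t, (C (stoppedRate σ.tau σ.rate s (ω.stopAt (σ.tau ω)))).toENNReal
        ∂levelMeasure E.Lmax =
      ∫⁻ s in Iic (σ.tau ω), (C (σ.rate s ω)).toENNReal ∂levelMeasure E.Lmax := by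
  simp only [stoppedRate_stopAt hσ.stopping hσ.rate.prog]
  have : (fun s => (C (stoppedRate σ.tau σ.rate s ω)).toENNReal) =
      (Iic (σ.tau ω)).indicator fun s => (C (σ.rate s ω)).toENNReal := by
    funext s
    by_cases h : s ≤ σ.tau ω <;> simp [stoppedRate, h, hC]
  rw [this, setLIntegral_indicator measurableSet_Iic, Iic_inter_Iic, min_eq_left ht]

/-! ### The quota with the fixed tax -/

theorem phiStar_of_le (hE : E.Regular) {l : Level E.Lmax} (hl : l ≤ quota hE) :
    E.phiStar l = (E.taxStar : EReal) := if_pos (show (l : ℝ) ≤ E.Lstar from hl)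

theorem phiStar_of_gt (hE : E.Regular) {l : Level E.Lmax} (hl : quota hE < l) :
    E.phiStar l = ⊤ := if_neg (not_le_of_gt (show E.Lstar < (l : ℝ) from hl))

theorem ae_tau_le_quota (hE : E.Regular) {C : ℝ → EReal} {H : ℝ → ℝ} {σ : Strategy E.Lmax}
    (hσ : E.Admissible H σ) (hpay : E.agentPayoff E.phiStar C σ ≠ ⊥) :
    ∀ᵐ ω ∂σ.law, σ.tau ω ≤ quota hE := by
  have hτ := measurable_of_isStoppingTime E.Lmax_pos.le hσ.stopping
  have hA : MeasurableSet {ω | quota hE < σ.tau ω} := hτ measurableSet_Ioi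
  have hneg := lintegral_neg_ne_top hpay
  have h0 : σ.law {ω | quota hE < σ.tau ω} = 0 := by
    by_contra h
    refine hneg (top_le_iff.1 ?_)
    rw [← ENNReal.top_mul h, ← lintegral_indicator_const hA ⊤]
    refine lintegral_mono fun ω => ?_
    by_cases h : quota hE < σ.tau ω
    · simp only [phiStar_of_gt hE h, EReal.sub_top, EReal.bot_sub, EReal.neg_bot,
        EReal.toENNReal_top, le_top]
    · rw [indicator_of_notMem (by simpa using h)]
      exact zero_le
  rw [ae_iff]
  simpa using h0

/-- Under the quota, waiting without learning does not hurt the agent. -/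
theorem agentPayoff_le_wait (hE : E.Regular) {C : ℝ → EReal} (hC : IsCost C) {H : ℝ → ℝ}
    (hH : IsUncertaintyMeasure H) {σ : Strategy E.Lmax} (hσ : E.Admissible H σ)
    (hquota : ∀ᵐ ω ∂σ.law, σ.tau ω ≤ quota hE) :
    E.agentPayoff E.phiStar C σ ≤
      E.agentPayoff E.phiStar C (stopLearning σ (waitTau hE σ.tau)) := by
  have hS := measurable_stopAt' E.Lmax_pos.le hσ.stopping
  have hσ' := admissible_stopLearning hH hσ (isStoppingTime_waitTau hE hσ.stopping)
  have hm := measurable_agentPayoff_integrand hE (isMechanism_quotaTax E.Lstar E.taxStar) hC hσ'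
  have hmap := extExpectation_map (P := σ.law) hS hm
  refine (extExpectation_mono ?_).trans_eq hmap.symm
  filter_upwards [hquota] with ω hω
  have hx := ω.mem_Icc (σ.tau ω)
  have htau : waitTau hE σ.tau (ω.stopAt (σ.tau ω)) = waitTau hE σ.tau ω := by
    simp only [waitTau, tau_stopAt hσ.stopping, stopAt_apply_of_le le_rfl]
  have hle : σ.tau ω ≤ waitTau hE σ.tau ω := le_max_left _ _
  have hU : E.U (ω (σ.tau ω)) (σ.tau ω) ≤ E.U (ω (σ.tau ω)) (waitTau hE σ.tau ω) := by
    rcases le_total (waitLevel hE (ω (σ.tau ω))) (σ.tau ω) with h | h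
    · rw [waitTau, max_eq_left h]
    · rw [waitTau, max_eq_right h]
      refine (hE.singlePeaked_U _ hx).le_of_le_sSup E.Lmax_pos.le (hE.usc_U hx) (σ.tau ω).2.1 h ?_
      rw [coe_waitLevel hE hx]
      exact min_le_left _ _
  have hq : waitTau hE σ.tau ω ≤ quota hE := max_le hω (min_le_right _ _)
  change _ ≤ (E.U (ω.stopAt (σ.tau ω) (waitTau hE σ.tau (ω.stopAt (σ.tau ω))))
      (waitTau hE σ.tau (ω.stopAt (σ.tau ω))) : EReal) -
      E.phiStar (waitTau hE σ.tau (ω.stopAt (σ.tau ω))) -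
      ((∫⁻ s in Iic (waitTau hE σ.tau (ω.stopAt (σ.tau ω))),
        (C (stoppedRate σ.tau σ.rate s (ω.stopAt (σ.tau ω)))).toENNReal
          ∂levelMeasure E.Lmax : ℝ≥0∞) : EReal)
  rw [htau, stopAt_apply_of_ge hle, lintegral_cost_stopAt hC.2.1 hσ ω hle, phiStar_of_le hE hq,
    phiStar_of_le hE hω]
  exact EReal.sub_le_sub (EReal.sub_le_sub (EReal.coe_le_coe_iff.2 hU) le_rfl) le_rfl

/-- Breaking indifference in favor of more R&D, the agent does not stop before the quota unless
her preferred level is reached. -/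
theorem ae_waitLevel_le_tau (hE : E.Regular) {C : ℝ → EReal} (hC : IsCost C) {H : ℝ → ℝ}
    (hH : IsUncertaintyMeasure H) {σ : Strategy E.Lmax}
    (hσ : E.IsBestResponse E.phiStar C H (some σ))
    (hquota : ∀ᵐ ω ∂σ.law, σ.tau ω ≤ quota hE) :
    ∀ᵐ ω ∂σ.law, waitLevel hE (ω (σ.tau ω)) ≤ σ.tau ω := by
  obtain ⟨hadm, -, hopt, htie⟩ := hσ
  have hS := measurable_stopAt' E.Lmax_pos.le hadm.stopping
  have hσ' := admissible_stopLearning hH hadm (isStoppingTime_waitTau hE hadm.stopping)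
  have h := htie _ hσ' rfl (Eventually.of_forall fun ω => le_max_left _ _)
    (le_antisymm (hopt _ hσ') (agentPayoff_le_wait hE hC hH hadm hquota))
  filter_upwards [ae_of_ae_map hS.aemeasurable h] with ω hω
  have hω' : max (σ.tau (ω.stopAt (σ.tau ω)))
      (waitLevel hE (ω.stopAt (σ.tau ω) (σ.tau (ω.stopAt (σ.tau ω))))) =
      σ.tau (ω.stopAt (σ.tau ω)) := hω
  rw [tau_stopAt hadm.stopping, stopAt_apply_of_le le_rfl] at hω'
  exact max_eq_left_iff.1 hω'

/-- Whatever the agent learns, under the quota with the fixed tax the principal gets at least the joint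
surplus at `L*` under the prior: at the agent's stopping level the principal, whose preferred
level is lower, would not gain by going on to `L*`, and the payoff at `L*` is affine in the belief. -/
theorem le_principalPayoff_phiStar (hE : E.Regular) {C : ℝ → EReal} {H : ℝ → ℝ}
    (he : (C, H) ∈ extPairs) {r : Option (Strategy E.Lmax)}
    (hr : E.IsBestResponse E.phiStar C H r) :
    ((E.V E.prior E.Lstar + E.taxStar : ℝ) : EReal) ≤ E.principalPayoff E.phiStar r := by
  obtain ⟨hC, hH⟩ := he
  cases r with
  | none =>
    refine absurd (hr _ (admissible_noLearning hH (quota hE))) (not_lt_of_ge ?_)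
    rw [agentPayoff_noLearning _ hC.2.1, phiStar_of_le hE le_rfl, ← EReal.coe_sub,
      EReal.coe_le_coe_iff, taxStar]
    exact (sub_sub_cancel _ _).ge
  | some σ =>
    have hσ := hr.1
    have hprob := hσ.learning.prob
    have hbot : E.agentPayoff E.phiStar C σ ≠ ⊥ := fun h => by
      have := hr.2.1
      rw [h] at this
      simp at this
    have hquota := ae_tau_le_quota hE hσ hbot
    have hbel : Integrable (fun ω : BeliefPath E.Lmax => ω (σ.tau ω)) σ.law :=
      (integrable_const (1 : ℝ)).mono' (measurable_belief_tau hσ).aestronglyMeasurable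
        (Eventually.of_forall fun ω => abs_belief_le ω _)
    have haff : ∀ μ, E.V μ E.Lstar + E.taxStar =
        μ * (E.v true E.Lstar - E.v false E.Lstar) + (E.v false E.Lstar + E.taxStar) := by
      intro μ
      simp only [V, indirect]
      ring
    have hint : Integrable (fun ω : BeliefPath E.Lmax =>
        E.V (ω (σ.tau ω)) E.Lstar + E.taxStar) σ.law := by
      simp only [haff]
      exact (hbel.mul_const _).add (integrable_const _)
    have hval : ∫ ω, (E.V (ω (σ.tau ω)) E.Lstar + E.taxStar) ∂σ.law =
        E.V E.prior E.Lstar + E.taxStar := by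
      simp only [haff]
      rw [integral_add (hbel.mul_const _) (integrable_const _), integral_mul_const,
        integral_belief_tau hσ]
      simp
    rw [← hval, ← extExpectation_coe hint]
    refine extExpectation_mono ?_
    filter_upwards [hquota, ae_waitLevel_le_tau hE hC hH hr hquota] with ω h1 h2
    have hx := ω.mem_Icc (σ.tau ω)
    have h1' : (σ.tau ω : ℝ) ≤ E.Lstar := h1
    have h2' : min (E.peakU (ω (σ.tau ω))) E.Lstar ≤ (σ.tau ω : ℝ) := by
      rw [← coe_waitLevel hE hx]
      exact h2
    have hV : E.V (ω (σ.tau ω)) E.Lstar ≤ E.V (ω (σ.tau ω)) (σ.tau ω) := by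
      rcases min_le_iff.1 h2' with h | h
      · exact (hE.singlePeaked_V _ hx).le_of_sSup_le ((hE.peakV_le_peakU _ hx).trans h) h1'
          (Lstar_mem hE).1.2
      · rw [le_antisymm h1' h]
    rw [phiStar_of_le hE h1, ← EReal.coe_add, EReal.coe_le_coe_iff]
    linarith

end Environment
end TechReg

open TechReg
theorem mainTheorem4 (E : Environment) (hE : E.Regular)
    (sel : (Level E.Lmax → EReal) → (ℝ → EReal) → (ℝ → ℝ) → Option (Strategy E.Lmax))
    (hsel : E.IsSelection sel) (𝓔 : Set ((ℝ → EReal) × (ℝ → ℝ)))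
    (h𝓔 : 𝓔 = realPairs ∨ 𝓔 = extPairs) :
    E.IsMechanism E.phiStar ∧
      E.worstCase sel 𝓔 E.phiStar = E.ACQ sel 𝓔 ∧
      E.ACQ sel 𝓔 = ((E.V E.prior E.Lstar + E.taxStar : ℝ) : EReal) := by
  have hmech : E.IsMechanism E.phiStar := Environment.isMechanism_quotaTax _ _
  have hsub : realPairs ⊆ 𝓔 := by
    rcases h𝓔 with rfl | rfl
    · exact subset_rfl
    · exact fun e he => he.1
  have hext : 𝓔 ⊆ extPairs := by
    rcases h𝓔 with rfl | rfl
    · exact fun e he => he.1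
    · exact subset_rfl
  have hlower : ((E.V E.prior E.Lstar + E.taxStar : ℝ) : EReal) ≤ E.worstCase sel 𝓔 E.phiStar :=
    le_iInf₂ fun e he => Environment.le_principalPayoff_phiStar hE (hext he.1)
      (hsel _ _ _ hmech (hext he.1) he.2)
  have hACQ : E.worstCase sel 𝓔 E.phiStar ≤ E.ACQ sel 𝓔 :=
    le_iSup₂_of_le (f := fun φ (_ : φ ∈ {φ | E.IsMechanism φ}) => E.worstCase sel 𝓔 φ)
      E.phiStar hmech le_rfl
  have hupper : E.ACQ sel 𝓔 ≤ ((E.V E.prior E.Lstar + E.taxStar : ℝ) : EReal) := by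
    refine iSup₂_le fun φ hφ => ?_
    obtain ⟨e, he, hex, hle⟩ := Environment.exists_pair_principalPayoff_le hE hφ
    exact iInf₂_le_of_le e ⟨hsub he, hex⟩ (hle _ (hsel _ _ _ hφ (hext (hsub he)) hex))
  exact ⟨hmech, le_antisymm hACQ (hupper.trans hlower),
    le_antisymm hupper (hlower.trans hACQ)⟩
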